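/- Let $\nu>0$ and let $n,n'\ge 0$ be integers. Let $\lambda$ be Lebesgue measure on $\mathbb{C}$ and $L^{2,\nu}(\mathbb{C})=L^2(\mathbb{C},e^{-\nu|z|^2}d\lambda)$, with inner product $\langle f,g\rangle=\int_{\mathbb{C}} f\,\overline{g}\,e^{-\nu|z|^2}d\lambda$. For integers $m,k\ge 0$ define the univariate complex Hermite polynomials $$H^\nu_{m,k}(z,\bar z)=(-1)^{m+k}e^{\nu z\bar z}\frac{\partial^{m+k}}{\partial\bar z^{m}\partial z^{k}}\left(e^{-\nu z\bar z}\right),$$ and define the generalized Bargmann–Fock space of level $k$ $$\mathcal{F}^{2,\nu}_k=\{f\in L^{2,\nu}(\mathbb{C})\cap C^2(\mathbb{C}) : \Delta_\nu f=\nu k\,f\},\qquad \Delta_\nu=-\frac{\partial^2}{\partial z\,\partial\bar z}+\nu\bar z\frac{\partial}{\partial\bar z}.$$ For $\psi\in\mathcal{F}^{2,\nu}_n$ set $$\mathcal{T}^\nu_{n,n'}(\psi)(z)=\frac{(-1)^{n'}\nu}{\pi\sqrt{n!\,n'!\,\nu^{n+n'}}}\int_{\mathbb{C}}e^{-\nu|\xi|^2+\nu\bar\xi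 z}\,H^\nu_{n,n'}(\xi-z,\bar\xi-\bar z)\,\psi(\xi)\,d\lambda(\xi),\qquad z\in\mathbb{C}.$$ Then this integral converges absolutely for every $\psi\in\mathcal{F}^{2,\nu}_n$ and $z\in\mathbb{C}$, and $\mathcal{T}^\nu_{n,n'}$ is a unitary operator (a linear bijection preserving the inner product) from $\mathcal{F}^{2,\nu}_n$ onto $\mathcal{F}^{2,\nu}_{n'}$, with inverse $(\mathcal{T}^\nu_{n,n'})^{-1}=\mathcal{T}^\nu_{n',n}$. Moreover, for every integer $m\ge 0$, $H^\nu_{m,n}\in\mathcal{F}^{2,\nu}_n$ and $$\mathcal{T}^\nu_{n,n'}(H^\nu_{m,n})(z)=\left(\frac{n!\,\nu^{n}}{n'!\,\nu^{n'}}\right)^{1/2}H^\nu_{m,n'}(z,\bar z)\qquad\text{for all } z\in\mathbb{C}.$$ -/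

import Mathlib

open MeasureTheory
open scoped ComplexConjugate

noncomputable section

namespace BargmannFock

/-- The Wirtinger derivative `∂/∂z = (∂/∂x - i ∂/∂y) / 2`. -/
def wirtingerZ (f : ℂ → ℂ) (z : ℂ) : ℂ :=
  (1 / 2) * (fderiv ℝ f z 1 - Complex.I * fderiv ℝ f z Complex.I)

/-- The conjugate Wirtinger derivative `∂/∂z̄ = (∂/∂x + i ∂/∂y) / 2`. -/
def wirtingerZBar (f : ℂ → ℂ) (z : ℂ) : ℂ :=
  (1 / 2) * (fderiv ℝ f z 1 + Complex.I * fderiv ℝ f z Complex.I)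

/-- The univariate complex Hermite polynomial
`H_{m,n}^ν(z, z̄) = (-1)^(m+n) e^{ν z z̄} ∂^{m+n} / (∂z̄^m ∂z^n) e^{-ν z z̄}`,
as a function of `z`. -/
def hermite (ν : ℝ) (m n : ℕ) (z : ℂ) : ℂ :=
  (-1) ^ (m + n) * Complex.exp (ν * z * conj z) *
    (wirtingerZBar^[m] (wirtingerZ^[n] fun w => Complex.exp (-(ν * w * conj w)))) z

/-- The measure `e^{-ν|z|²} dλ(z)` on `ℂ`, where `λ` is Lebesgue measure. -/
def gaussMeasure (ν : ℝ) : Measure ℂ :=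
  volume.withDensity fun z => ENNReal.ofReal (Real.exp (-(ν * ‖z‖ ^ 2)))

/-- The inner product of `L²(ℂ, e^{-ν|z|²} dλ)`, linear in the first argument. -/
def innerProd (ν : ℝ) (f g : ℂ → ℂ) : ℂ :=
  ∫ z, f z * conj (g z) ∂(gaussMeasure ν)

/-- The magnetic Schrödinger operator `Δ_ν = -∂²/∂z∂z̄ + ν z̄ ∂/∂z̄`. -/
def magneticLaplacian (ν : ℝ) (f : ℂ → ℂ) (z : ℂ) : ℂ :=
  -wirtingerZ (wirtingerZBar f) z + ν * conj z * wirtingerZBar f z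

theorem contDiff_wirtingerZBar {f : ℂ → ℂ} (hf : ContDiff ℝ 2 f) :
    ContDiff ℝ 1 (wirtingerZBar f) := by
  have h : ContDiff ℝ 1 (fderiv ℝ f) := hf.fderiv_right (by norm_num)
  have h1 : ContDiff ℝ 1 fun z => fderiv ℝ f z 1 := h.clm_apply contDiff_const
  have h2 : ContDiff ℝ 1 fun z => fderiv ℝ f z Complex.I := h.clm_apply contDiff_const
  exact contDiff_const.mul (h1.add (contDiff_const.mul h2))

theorem wirtingerZBar_add {f g : ℂ → ℂ} (hf : Differentiable ℝ f) (hg : Differentiable ℝ g) :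
    wirtingerZBar (f + g) = wirtingerZBar f + wirtingerZBar g := by
  funext z
  simp only [wirtingerZBar, Pi.add_apply, fderiv_add (hf z) (hg z), add_apply]
  ring

theorem wirtingerZ_add {f g : ℂ → ℂ} (hf : Differentiable ℝ f) (hg : Differentiable ℝ g) :
    wirtingerZ (f + g) = wirtingerZ f + wirtingerZ g := by
  funext z
  simp only [wirtingerZ, Pi.add_apply, fderiv_add (hf z) (hg z), add_apply]
  ring

theorem wirtingerZBar_smul (c : ℂ) {f : ℂ → ℂ} (hf : Differentiable ℝ f) :
    wirtingerZBar (c • f) = c • wirtingerZBar f := by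
  funext z
  simp only [wirtingerZBar, Pi.smul_apply, fderiv_const_smul (hf z) c,
    smul_apply, smul_eq_mul]
  ring

theorem wirtingerZ_smul (c : ℂ) {f : ℂ → ℂ} (hf : Differentiable ℝ f) :
    wirtingerZ (c • f) = c • wirtingerZ f := by
  funext z
  simp only [wirtingerZ, Pi.smul_apply, fderiv_const_smul (hf z) c,
    smul_apply, smul_eq_mul]
  ring

/-- The generalized Bargmann–Fock space of level `n`: the twice continuously differentiable
square integrable functions with respect to `e^{-ν|z|²} dλ` such that `Δ_ν f = ν n f`.
(As `Δ_ν` is elliptic, every distributional eigenfunction in `L²` agrees almost everywhere with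
exactly one such function.) -/
def fockSpace (ν : ℝ) (n : ℕ) : Submodule ℂ (ℂ → ℂ) where
  carrier := {f | ContDiff ℝ 2 f ∧ MemLp f 2 (gaussMeasure ν) ∧
    ∀ z, magneticLaplacian ν f z = (ν * n : ℂ) * f z}
  zero_mem' := by
    refine ⟨contDiff_const, MemLp.zero, fun z => ?_⟩
    have h1 : wirtingerZBar 0 = 0 := by funext w; simp [wirtingerZBar]
    simp [magneticLaplacian, h1, wirtingerZ]
  add_mem' := by
    rintro f g ⟨hf, hf2, hfe⟩ ⟨hg, hg2, hge⟩
    refine ⟨hf.add hg, hf2.add hg2, fun z => ?_⟩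
    have h := hfe z
    have h' := hge z
    simp only [magneticLaplacian] at h h' ⊢
    rw [wirtingerZBar_add (hf.differentiable (by norm_num)) (hg.differentiable (by norm_num)),
      wirtingerZ_add ((contDiff_wirtingerZBar hf).differentiable (by norm_num))
        ((contDiff_wirtingerZBar hg).differentiable (by norm_num))]
    simp only [Pi.add_apply]
    linear_combination h + h'
  smul_mem' := by
    rintro c f ⟨hf, hf2, hfe⟩
    refine ⟨contDiff_const.smul hf, hf2.const_smul c, fun z => ?_⟩
    have h := hfe z
    simp only [magneticLaplacian] at h ⊢
    rw [wirtingerZBar_smul c (hf.differentiable (by norm_num)),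
      wirtingerZ_smul c ((contDiff_wirtingerZBar hf).differentiable (by norm_num))]
    simp only [Pi.smul_apply, smul_eq_mul]
    linear_combination c * h

/-- The integrand `e^{-ν|ξ|² + ν ξ̄ z} H_{n,n'}^ν(ξ - z, ξ̄ - z̄) ψ(ξ)` of the transform. -/
def integrand (ν : ℝ) (n n' : ℕ) (ψ : ℂ → ℂ) (z ξ : ℂ) : ℂ :=
  Complex.exp (-(ν * ‖ξ‖ ^ 2) + ν * conj ξ * z) * hermite ν n n' (ξ - z) * ψ ξ

/-- The integral transform `𝒯_{n,n'}^ν`. -/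
def transform (ν : ℝ) (n n' : ℕ) (ψ : ℂ → ℂ) (z : ℂ) : ℂ :=
  (((-1) ^ n' * ν / (Real.pi * Real.sqrt (n.factorial * n'.factorial * ν ^ (n + n'))) : ℝ) : ℂ) *
    ∫ ξ, integrand ν n n' ψ z ξ

end BargmannFock

end

/-!
# Unitary transforms between generalized Bargmann–Fock spaces

Write `A = ∂/∂z̄` and `A⁺ = -∂/∂z + ν z̄`. Then `Δ_ν = A⁺ A`, the commutator `[A, A⁺]` is `ν`, and
`A` and `A⁺` are adjoint to each other in `L²(ℂ, e^{-ν|z|²} dλ)`. Hence the levels `𝓕_n` form the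
ladder of a harmonic oscillator: `A` maps `𝓕_{n+1}` to `𝓕_n`, `A⁺` maps `𝓕_n` to `𝓕_{n+1}`, the
products `A A⁺` and `A⁺ A` are scalars on each level, and `𝓕_0` consists of the holomorphic,
square integrable functions. So `(A⁺)^{n'} A^n`, divided by `√(n! n'! ν^{n+n'})`, is a unitary map from `𝓕_n` onto
`𝓕_{n'}`, and it remains to see that the integral transform is this map (`transform_eq`).

For the ladder two analytic points have to be settled, because an element of `𝓕_n` is only assumed
to be a `C²` function in `L²`. First, `A f` and `A⁺ f` are again `C²`
(`contDiff_two_of_wirtingerZBar`, `contDiff_two_of_creation`): one more derivative of them is a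
multiple of `f`, and the equation `∂w/∂z̄ = u` is solved without loss of smoothness by the Cauchy
transform. Secondly, `A f` and `A⁺ f` are in `L²` (`memLp_wirtingerZBar`, `memLp_creation`): this
is a Caccioppoli estimate with cutoff functions, and another cutoff argument gives the adjointness
(`innerProd_wirtingerZBar`).

For the transform, the substitution `ξ = z + η` turns the integral into the pairing of the
magnetic translate `ψ_z(η) = e^{-ν z̄ η} ψ(z + η)` with `H_{n',n} = (A⁺)^n (ν η)^{n'}`
(`integral_integrand`, `hermite_eq_iterate_creation`). Moving `(A⁺)^n` to the other side leaves
the pairing of the holomorphic function `A^n ψ_z = (A^n ψ)_z` with a monomial. In polar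
coordinates, the Cauchy integral formula identifies it with a Taylor coefficient at the origin
(`innerProd_pow`), that is, up to a constant, with the value of `(A⁺)^{n'} A^n ψ` at `z`
(`iterate_creation_apply_zero`), because `A⁺` commutes with magnetic translations.
-/

noncomputable section

namespace BargmannFock

/-! ### Wirtinger calculus -/

/-- The creation operator `A⁺ = -∂/∂z + ν z̄`, the formal adjoint of `∂/∂z̄` with respect to the
Gaussian weight `e^{-ν|z|²}`. -/
def creation (ν : ℝ) (f : ℂ → ℂ) (z : ℂ) : ℂ :=
  -wirtingerZ f z + ν * conj z * f z

/-- The Gaussian weight `e^{-ν|z|²}`, as a complex valued function. -/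
def weight (ν : ℝ) (z : ℂ) : ℂ := Complex.exp (-(ν * z * conj z))

theorem contDiff_fderiv_apply {f : ℂ → ℂ} {m n : WithTop ℕ∞} (hf : ContDiff ℝ n f) (h : m + 1 ≤ n)
    (v : ℂ) : ContDiff ℝ m fun z => fderiv ℝ f z v :=
  (hf.fderiv_right h).clm_apply contDiff_const

theorem contDiff_wirtingerZ {f : ℂ → ℂ} {m n : WithTop ℕ∞} (hf : ContDiff ℝ n f) (h : m + 1 ≤ n) :
    ContDiff ℝ m (wirtingerZ f) :=
  contDiff_const.mul ((contDiff_fderiv_apply hf h 1).sub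
    (contDiff_const.mul (contDiff_fderiv_apply hf h Complex.I)))

theorem contDiff_wirtingerZBar_of_le {f : ℂ → ℂ} {m n : WithTop ℕ∞} (hf : ContDiff ℝ n f)
    (h : m + 1 ≤ n) : ContDiff ℝ m (wirtingerZBar f) :=
  contDiff_const.mul ((contDiff_fderiv_apply hf h 1).add
    (contDiff_const.mul (contDiff_fderiv_apply hf h Complex.I)))

theorem contDiff_creation {ν : ℝ} {f : ℂ → ℂ} {m n : WithTop ℕ∞} (hf : ContDiff ℝ n f)
    (h : m + 1 ≤ n) : ContDiff ℝ m (creation ν f) := by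
  have h1 : ContDiff ℝ m f := hf.of_le (le_trans (by simp) h)
  exact (contDiff_wirtingerZ hf h).neg.add
    ((contDiff_const.mul Complex.conjCLE.contDiff).mul h1)

theorem wirtingerZ_mul {f g : ℂ → ℂ} {z : ℂ} (hf : DifferentiableAt ℝ f z)
    (hg : DifferentiableAt ℝ g z) :
    wirtingerZ (fun w => f w * g w) z = wirtingerZ f z * g z + f z * wirtingerZ g z := by
  simp only [wirtingerZ, fderiv_fun_mul hf hg, add_apply, smul_apply, smul_eq_mul]
  ring

theorem wirtingerZBar_mul {f g : ℂ → ℂ} {z : ℂ} (hf : DifferentiableAt ℝ f z)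
    (hg : DifferentiableAt ℝ g z) :
    wirtingerZBar (fun w => f w * g w) z = wirtingerZBar f z * g z + f z * wirtingerZBar g z := by
  simp only [wirtingerZBar, fderiv_fun_mul hf hg, add_apply, smul_apply, smul_eq_mul]
  ring

theorem fderiv_conj {f : ℂ → ℂ} {z : ℂ} (hf : DifferentiableAt ℝ f z) (v : ℂ) :
    fderiv ℝ (fun w => conj (f w)) z v = conj (fderiv ℝ f z v) := by
  have h := (Complex.conjCLE.toContinuousLinearMap.hasFDerivAt.comp z hf.hasFDerivAt).fderiv
  have h2 : (fun w => conj (f w)) = (Complex.conjCLE.toContinuousLinearMap : ℂ → ℂ) ∘ f := by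
    ext w; simp
  rw [h2, h]
  simp

theorem wirtingerZ_conj {f : ℂ → ℂ} {z : ℂ} (hf : DifferentiableAt ℝ f z) :
    wirtingerZ (fun w => conj (f w)) z = conj (wirtingerZBar f z) := by
  simp only [wirtingerZ, wirtingerZBar, fderiv_conj hf, map_mul, map_add, Complex.conj_I, map_div₀,
    map_one, map_ofNat]
  ring

theorem wirtingerZBar_conj {f : ℂ → ℂ} {z : ℂ} (hf : DifferentiableAt ℝ f z) :
    wirtingerZBar (fun w => conj (f w)) z = conj (wirtingerZ f z) := by
  simp only [wirtingerZ, wirtingerZBar, fderiv_conj hf, map_mul, map_sub, Complex.conj_I, map_div₀,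
    map_one, map_ofNat]
  ring

theorem fderiv_of_hasDerivAt {g : ℂ → ℂ} {g' z : ℂ} (h : HasDerivAt g g' z) (v : ℂ) :
    fderiv ℝ g z v = v * g' := by
  rw [(h.hasFDerivAt.restrictScalars ℝ).fderiv]
  simp

theorem wirtingerZ_of_hasDerivAt {g : ℂ → ℂ} {g' z : ℂ} (h : HasDerivAt g g' z) :
    wirtingerZ g z = g' := by
  simp only [wirtingerZ, fderiv_of_hasDerivAt h]
  linear_combination (-(1 / 2) * g') * Complex.I_mul_I

theorem wirtingerZBar_of_hasDerivAt {g : ℂ → ℂ} {g' z : ℂ} (h : HasDerivAt g g' z) :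
    wirtingerZBar g z = 0 := by
  simp only [wirtingerZBar, fderiv_of_hasDerivAt h]
  linear_combination ((1 / 2) * g') * Complex.I_mul_I

theorem wirtingerZBar_conj_of_hasDerivAt {g : ℂ → ℂ} {g' z : ℂ} (h : HasDerivAt g g' z) :
    wirtingerZBar (fun w => conj (g w)) z = conj g' := by
  rw [wirtingerZBar_conj (h.differentiableAt.restrictScalars ℝ), wirtingerZ_of_hasDerivAt h]

theorem wirtingerZ_conj_of_hasDerivAt {g : ℂ → ℂ} {g' z : ℂ} (h : HasDerivAt g g' z) :
    wirtingerZ (fun w => conj (g w)) z = 0 := by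
  rw [wirtingerZ_conj (h.differentiableAt.restrictScalars ℝ), wirtingerZBar_of_hasDerivAt h,
    map_zero]

/-- The Cauchy–Riemann equations in Wirtinger form. -/
theorem differentiableAt_of_wirtingerZBar_eq_zero {g : ℂ → ℂ} {z : ℂ}
    (hg : DifferentiableAt ℝ g z) (h : wirtingerZBar g z = 0) : DifferentiableAt ℂ g z := by
  refine differentiableAt_complex_iff_differentiableAt_real.2 ⟨hg, ?_⟩
  simp only [wirtingerZBar] at h
  rw [smul_eq_mul]
  linear_combination (-2 * Complex.I) * h - (-fderiv ℝ g z Complex.I) * Complex.I_mul_I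

theorem wirtingerZ_wirtingerZBar_comm {f : ℂ → ℂ} (hf : ContDiff ℝ 2 f) :
    wirtingerZ (wirtingerZBar f) = wirtingerZBar (wirtingerZ f) := by
  funext z
  have hd : Differentiable ℝ (fderiv ℝ f) :=
    (hf.fderiv_right (m := 1) (by norm_num)).differentiable (by norm_num)
  have hsymm : ∀ v w, fderiv ℝ (fderiv ℝ f) z v w = fderiv ℝ (fderiv ℝ f) z w v := by
    intro v w
    exact (hf.contDiffAt.isSymmSndFDerivAt (by simp)) v w
  have hv : ∀ v w, fderiv ℝ (fun y => fderiv ℝ f y v) z w = fderiv ℝ (fderiv ℝ f) z w v := by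
    intro v w
    rw [fderiv_clm_apply (hd z) (differentiableAt_const v)]
    simp
  have hdv : ∀ v, DifferentiableAt ℝ (fun y => fderiv ℝ f y v) z := fun v =>
    (hd z).clm_apply (differentiableAt_const v)
  have h1 : ∀ v, fderiv ℝ (wirtingerZBar f) z v = (1 / 2) * (fderiv ℝ (fderiv ℝ f) z v 1 +
      Complex.I * fderiv ℝ (fderiv ℝ f) z v Complex.I) := by
    intro v
    have : wirtingerZBar f = fun y => (1 / 2 : ℂ) * (fderiv ℝ f y 1 +
      Complex.I * fderiv ℝ f y Complex.I) := rfl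
    rw [this, fderiv_const_mul ((hdv 1).fun_add ((hdv Complex.I).const_mul _)),
      fderiv_fun_add (hdv 1) ((hdv Complex.I).const_mul _), fderiv_const_mul (hdv Complex.I)]
    simp [hv]
    ring
  have h2 : ∀ v, fderiv ℝ (wirtingerZ f) z v = (1 / 2) * (fderiv ℝ (fderiv ℝ f) z v 1 -
      Complex.I * fderiv ℝ (fderiv ℝ f) z v Complex.I) := by
    intro v
    have : wirtingerZ f = fun y => (1 / 2 : ℂ) * (fderiv ℝ f y 1 -
      Complex.I * fderiv ℝ f y Complex.I) := rfl
    rw [this, fderiv_const_mul ((hdv 1).fun_sub ((hdv Complex.I).const_mul _)),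
      fderiv_fun_sub (hdv 1) ((hdv Complex.I).const_mul _), fderiv_const_mul (hdv Complex.I)]
    simp [hv]
  simp only [wirtingerZ, wirtingerZBar] at h1 h2 ⊢
  rw [h1, h1, h2, h2, hsymm 1 Complex.I]
  ring

theorem weight_eq (ν : ℝ) (z : ℂ) : weight ν z = (Real.exp (-(ν * ‖z‖ ^ 2)) : ℝ) := by
  rw [weight, mul_assoc, Complex.mul_conj, Complex.normSq_eq_norm_sq]
  push_cast
  rfl

theorem contDiff_weight (ν : ℝ) {n : WithTop ℕ∞} : ContDiff ℝ n (weight ν) := by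
  have : ContDiff ℝ n fun z : ℂ => conj z := Complex.conjCLE.contDiff
  exact ((contDiff_const.mul contDiff_id).mul this).neg.cexp

theorem conj_weight (ν : ℝ) (z : ℂ) : conj (weight ν z) = weight ν z := by
  rw [weight_eq, Complex.conj_ofReal]

theorem wirtingerZ_weight (ν : ℝ) (z : ℂ) :
    wirtingerZ (weight ν) z = -(ν * conj z) * weight ν z := by
  have hd : HasFDerivAt (fun w : ℂ => -(ν * w * conj w))
      (-((ν * z) • Complex.conjCLE.toContinuousLinearMap +
        (conj z) • ((ν : ℂ) • ContinuousLinearMap.id ℝ ℂ))) z := by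
    have h1 : HasFDerivAt (fun w : ℂ => conj w) Complex.conjCLE.toContinuousLinearMap z :=
      Complex.conjCLE.toContinuousLinearMap.hasFDerivAt
    exact (((hasFDerivAt_id z).const_mul (ν : ℂ)).mul h1).neg
  have h := hd.cexp.fderiv
  have h' : fderiv ℝ (weight ν) z = _ := h
  simp only [wirtingerZ, h', weight, smul_apply, neg_apply, add_apply, smul_eq_mul]
  simp
  linear_combination (Complex.exp (-(ν * z * conj z)) * ν * (conj z / 2 - z / 2)) * Complex.I_sq

theorem wirtingerZBar_weight (ν : ℝ) (z : ℂ) :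
    wirtingerZBar (weight ν) z = -(ν * z) * weight ν z := by
  have hd : DifferentiableAt ℝ (weight ν) z :=
    ((contDiff_weight ν (n := 1)).differentiable one_ne_zero) z
  have h : weight ν = fun w => conj (weight ν w) := by ext w; rw [conj_weight]
  rw [h, wirtingerZBar_conj hd, wirtingerZ_weight]
  simp [conj_weight]

/-- The creation operator is `-∂/∂z`, conjugated by the Gaussian weight. -/
theorem wirtingerZ_weight_mul {ν : ℝ} {f : ℂ → ℂ} {z : ℂ} (hf : DifferentiableAt ℝ f z) :
    wirtingerZ (fun w => weight ν w * f w) z = -(weight ν z * creation ν f z) := by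
  rw [wirtingerZ_mul (((contDiff_weight ν (n := 1)).differentiable one_ne_zero) z) hf,
    wirtingerZ_weight, creation]
  ring

/-- The pointwise form of the adjointness of `∂/∂z̄` and `A⁺`: the difference of the two integrands
is a total `z̄`-derivative. -/
theorem wirtingerZBar_mul_conj_mul_weight {ν : ℝ} {f g : ℂ → ℂ} {z : ℂ}
    (hf : DifferentiableAt ℝ f z) (hg : DifferentiableAt ℝ g z) :
    wirtingerZBar (fun w => f w * conj (weight ν w * g w)) z =
      weight ν z * (wirtingerZBar f z * conj (g z) - f z * conj (creation ν g z)) := by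
  have hw : DifferentiableAt ℝ (fun w => weight ν w * g w) z :=
    (((contDiff_weight ν (n := 1)).differentiable one_ne_zero) z).mul hg
  have hc : DifferentiableAt ℝ (fun w => conj (weight ν w * g w)) z :=
    Complex.conjCLE.differentiableAt.comp z hw
  rw [wirtingerZBar_mul hf hc, wirtingerZBar_conj hw, wirtingerZ_weight_mul hg]
  simp only [map_neg, map_mul, conj_weight]
  ring

/-- The canonical commutation relation `[∂/∂z̄, A⁺] = ν`. -/
theorem wirtingerZBar_creation {ν : ℝ} {f : ℂ → ℂ} (hf : ContDiff ℝ 2 f) :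
    wirtingerZBar (creation ν f) = creation ν (wirtingerZBar f) + (ν : ℂ) • f := by
  funext z
  have hf1 : Differentiable ℝ f := hf.differentiable (by norm_num)
  have hz : Differentiable ℝ (wirtingerZ f) :=
    (contDiff_wirtingerZ hf (m := 1) (by norm_num)).differentiable (by norm_num)
  have hc : Differentiable ℝ (fun w : ℂ => ν * conj w) := fun w =>
    Complex.conjCLE.differentiableAt.const_mul _
  have hE : creation ν f = (-1 : ℂ) • wirtingerZ f + fun w => ν * conj w * f w := by
    ext w; simp [creation]
  have hcz : wirtingerZBar (fun w : ℂ => ν * conj w) z = ν := by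
    have := wirtingerZBar_conj_of_hasDerivAt (((hasDerivAt_id z).const_mul (ν : ℂ)))
    simpa using this
  rw [hE, wirtingerZBar_add (hz.const_smul _) (hc.fun_mul hf1), wirtingerZBar_smul _ hz]
  simp only [Pi.add_apply, Pi.smul_apply, smul_eq_mul]
  rw [wirtingerZBar_mul (hc z) (hf1 z), hcz, creation, wirtingerZ_wirtingerZBar_comm hf]
  ring

/-! ### The Cauchy transform and regularity -/

theorem exists_fderiv_eq_zero_of_lt_norm {u : ℂ → ℂ} (hc : HasCompactSupport u) :
    ∃ R : ℝ, 0 < R ∧ ∀ y, R < ‖y‖ → u y = 0 ∧ fderiv ℝ u y = 0 := by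
  obtain ⟨R, hR⟩ := hc.isCompact.isBounded.subset_closedBall (0 : ℂ)
  refine ⟨max R 1, by positivity, fun y hy => ?_⟩
  have hy' : y ∉ tsupport u := fun h => by
    have := hR h
    rw [mem_closedBall_zero_iff] at this
    exact absurd (le_max_of_le_left this) (not_le.2 hy)
  exact ⟨image_eq_zero_of_notMem_tsupport hy', fderiv_of_notMem_tsupport ℝ hy'⟩

theorem polarCoord_symm_eq_exp (p : ℝ × ℝ) :
    Complex.polarCoord.symm p = p.1 * Complex.exp (p.2 * Complex.I) := by
  rw [Complex.polarCoord_symm_apply, Complex.exp_mul_I]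
  push_cast
  rfl

theorem hasDerivAt_exp_mul_I (θ : ℝ) :
    HasDerivAt (fun t : ℝ => Complex.exp (t * Complex.I))
      (Complex.I * Complex.exp (θ * Complex.I)) θ := by
  have h : HasDerivAt (fun t : ℝ => (t : ℂ) * Complex.I) (1 * Complex.I) θ :=
    (Complex.ofRealCLM.hasDerivAt (x := θ)).mul_const _
  simpa [mul_comm] using h.cexp

/-- A continuous function on the half strip of polar coordinates that vanishes for large radius is
integrable. -/
theorem integrableOn_polar_of_continuous {F : ℝ × ℝ → ℂ} (hF : Continuous F) {R : ℝ}
    (h0 : ∀ p, R < p.1 → F p = 0) :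
    IntegrableOn F (Set.Ioi (0 : ℝ) ×ˢ Set.Ioo (-Real.pi) Real.pi) := by
  have h1 : IntegrableOn F (Set.Icc 0 R ×ˢ Set.Icc (-Real.pi) Real.pi) :=
    hF.continuousOn.integrableOn_compact (isCompact_Icc.prod isCompact_Icc)
  refine h1.of_forall_sdiff_eq_zero (measurableSet_Ioi.prod measurableSet_Ioo) ?_
  rintro ⟨r, θ⟩ ⟨⟨hr, hθ⟩, h⟩
  refine h0 _ (not_le.1 fun hrR => h ⟨⟨le_of_lt hr, hrR⟩, ⟨hθ.1.le, hθ.2.le⟩⟩)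

/-- The Cauchy–Pompeiu formula for compactly supported functions, proved in polar coordinates:
there `t⁻¹ ∂/∂t̄` becomes, up to the Jacobian, half the sum of a radial derivative, which integrates
to the value at the centre, and of an angular derivative, which integrates to zero. -/
theorem integral_inv_mul_wirtingerZBar {u : ℂ → ℂ} (hu : ContDiff ℝ 1 u)
    (hc : HasCompactSupport u) (x : ℂ) :
    ∫ t : ℂ, t⁻¹ * wirtingerZBar u (x - t) = Real.pi * u x := by
  obtain ⟨R, hR0, hR⟩ := exists_fderiv_eq_zero_of_lt_norm hc
  set e : ℝ → ℂ := fun θ => Complex.exp (θ * Complex.I) with he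
  have hec : Continuous e := by fun_prop
  have henorm : ∀ θ, ‖e θ‖ = 1 := Complex.norm_exp_ofReal_mul_I
  have hud : Differentiable ℝ u := hu.differentiable one_ne_zero
  have hfar : ∀ r θ, R + ‖x‖ < r → R < ‖x - r * e θ‖ := by
    intro r θ h
    have h1 : ‖(r : ℂ) * e θ‖ = r := by
      rw [norm_mul, henorm, mul_one, Complex.norm_real, Real.norm_of_nonneg]
      linarith [norm_nonneg x]
    have h2 := norm_sub_norm_le ((r : ℂ) * e θ) x
    rw [norm_sub_rev] at h2
    linarith
  -- `B₁` is minus the radial derivative of `u (x - r e^{iθ})`, and `B₂` is `-1 / r` times the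
  -- angular one.
  set B₁ : ℝ × ℝ → ℂ := fun p => fderiv ℝ u (x - p.1 * e p.2) (e p.2) with hB₁
  set B₂ : ℝ × ℝ → ℂ := fun p => fderiv ℝ u (x - p.1 * e p.2) (Complex.I * e p.2) with hB₂
  have hDc : Continuous (fderiv ℝ u) := hu.continuous_fderiv one_ne_zero
  have hc₁ : Continuous B₁ := by
    refine (hDc.comp ?_).clm_apply ?_ <;> fun_prop
  have hc₂ : Continuous B₂ := by
    refine (hDc.comp ?_).clm_apply ?_ <;> fun_prop
  have hi₁ := integrableOn_polar_of_continuous hc₁ (R := R + ‖x‖) (fun p hp => by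
    simp [hB₁, (hR _ (hfar p.1 p.2 hp)).2])
  have hi₂ := integrableOn_polar_of_continuous hc₂ (R := R + ‖x‖) (fun p hp => by
    simp [hB₂, (hR _ (hfar p.1 p.2 hp)).2])
  have hder : ∀ r θ : ℝ, HasDerivAt (fun s : ℝ => u (x - s * e θ)) (-(B₁ (r, θ))) r := by
    intro r θ
    have h1 : HasDerivAt (fun s : ℝ => x - s * e θ) (-(1 * e θ)) r :=
      ((Complex.ofRealCLM.hasDerivAt (x := r)).mul_const _).const_sub x
    exact ((hud (x - r * e θ)).hasFDerivAt.comp_hasDerivAt r h1).congr_deriv (by simp [hB₁])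
  have hder₂ : ∀ r θ : ℝ, HasDerivAt (fun s : ℝ => u (x - r * e s)) (-(r * (B₂ (r, θ)))) θ := by
    intro r θ
    have h1 : HasDerivAt (fun s : ℝ => x - r * e s) (-(r * (Complex.I * e θ))) θ :=
      ((hasDerivAt_exp_mul_I θ).const_mul _).const_sub x
    refine ((hud (x - r * e θ)).hasFDerivAt.comp_hasDerivAt θ h1).congr_deriv ?_
    have h2 : (r : ℂ) * (Complex.I * e θ) = r • (Complex.I * e θ) := by simp
    rw [map_neg, h2, map_smul]
    simp [hB₂]
  have hpi : -Real.pi ≤ Real.pi := by linarith [Real.pi_pos]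
  have hI₂ : ∫ p in Set.Ioi (0 : ℝ) ×ˢ Set.Ioo (-Real.pi) Real.pi, B₂ p = 0 := by
    rw [Measure.volume_eq_prod, setIntegral_prod _ (by rwa [← Measure.volume_eq_prod])]
    refine (setIntegral_congr_fun measurableSet_Ioi fun r hr => ?_).trans (integral_zero _ _)
    have hr0 : (r : ℂ) ≠ 0 := by exact_mod_cast (ne_of_gt hr)
    show ∫ θ in Set.Ioo (-Real.pi) Real.pi, B₂ (r, θ) = 0
    rw [← integral_Ioc_eq_integral_Ioo, ← intervalIntegral.integral_of_le hpi]
    have hci : Continuous fun θ => -((r : ℂ) * B₂ (r, θ)) := by fun_prop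
    have h3 := intervalIntegral.integral_eq_sub_of_hasDerivAt (fun θ _ => hder₂ r θ)
      (hci.intervalIntegrable (-Real.pi) Real.pi)
    have h4 : e Real.pi = e (-Real.pi) := by
      simp [he, Complex.exp_neg]
    rw [h4, sub_self, intervalIntegral.integral_neg, intervalIntegral.integral_const_mul,
      neg_eq_zero] at h3
    exact (mul_eq_zero.1 h3).resolve_left hr0
  have hI₁ : ∫ p in Set.Ioi (0 : ℝ) ×ˢ Set.Ioo (-Real.pi) Real.pi, B₁ p = 2 * Real.pi * u x := by
    have hi : Integrable B₁ ((volume.restrict (Set.Ioi (0 : ℝ))).prod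
        (volume.restrict (Set.Ioo (-Real.pi) Real.pi))) := by
      rw [Measure.prod_restrict, ← Measure.volume_eq_prod]; exact hi₁
    rw [Measure.volume_eq_prod, ← Measure.prod_restrict, integral_prod_symm _ hi]
    have h5 : ∀ θ, ∫ r in Set.Ioi (0 : ℝ), B₁ (r, θ) = u x := by
      intro θ
      have hcθ : Continuous fun r => B₁ (r, θ) := by fun_prop
      have hint : IntegrableOn (fun r => B₁ (r, θ)) (Set.Ioi 0) := by
        have h1 : IntegrableOn (fun r => B₁ (r, θ)) (Set.Icc 0 (R + ‖x‖)) :=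
          hcθ.continuousOn.integrableOn_compact isCompact_Icc
        refine h1.of_forall_sdiff_eq_zero measurableSet_Ioi ?_
        rintro r ⟨hr, h⟩
        have : R + ‖x‖ < r := not_le.1 fun hrR => h ⟨le_of_lt hr, hrR⟩
        simp [hB₁, (hR _ (hfar r θ this)).2]
      have ht : Filter.Tendsto (fun r : ℝ => -u (x - r * e θ)) Filter.atTop (nhds 0) := by
        refine tendsto_const_nhds.congr' ?_
        filter_upwards [Filter.eventually_gt_atTop (R + ‖x‖)] with r hr
        simp [(hR _ (hfar r θ hr)).1]
      have h6 := integral_Ioi_of_hasDerivAt_of_tendsto' (a := 0)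
        (fun r _ => by simpa using (hder r θ).fun_neg) hint ht
      rw [h6]
      simp
    simp only [h5]
    rw [setIntegral_const]
    simp [Real.volume_real_Ioo_of_le hpi]
    left
    ring
  have key : ∫ t : ℂ, t⁻¹ * wirtingerZBar u (x - t) =
      ∫ p in Set.Ioi (0 : ℝ) ×ˢ Set.Ioo (-Real.pi) Real.pi,
        ((1 / 2 : ℂ) * B₁ p + (Complex.I / 2) * B₂ p) := by
    rw [← Complex.integral_comp_polarCoord_symm]
    refine setIntegral_congr_fun (measurableSet_Ioi.prod measurableSet_Ioo) ?_
    rintro ⟨r, θ⟩ ⟨hr, -⟩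
    have hr0 : (r : ℂ) ≠ 0 := by exact_mod_cast (ne_of_gt hr)
    have hcs : Complex.exp (θ * Complex.I) = (Real.cos θ : ℝ) + (Real.sin θ : ℝ) * Complex.I := by
      rw [Complex.exp_mul_I]; push_cast; rfl
    have hinv : (Complex.exp (θ * Complex.I))⁻¹ =
        (Real.cos θ : ℝ) - (Real.sin θ : ℝ) * Complex.I := by
      rw [← Complex.exp_neg, ← neg_mul, Complex.exp_mul_I]
      simp [Complex.cos_neg, Complex.sin_neg, sub_eq_add_neg]
    simp only [polarCoord_symm_eq_exp, Complex.real_smul, hB₁, hB₂, he, wirtingerZBar, mul_inv,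
      hinv]
    set D := fderiv ℝ u (x - r * Complex.exp (θ * Complex.I))
    have hD₁ : D (Complex.exp (θ * Complex.I)) =
        (Real.cos θ : ℝ) * D 1 + (Real.sin θ : ℝ) * D Complex.I := by
      have : Complex.exp (θ * Complex.I) = Real.cos θ • (1 : ℂ) + Real.sin θ • Complex.I := by
        rw [hcs]; simp
      rw [this, map_add, map_smul, map_smul]; simp
    have hD₂ : D (Complex.I * Complex.exp (θ * Complex.I)) =
        (Real.cos θ : ℝ) * D Complex.I - (Real.sin θ : ℝ) * D 1 := by
      have : Complex.I * Complex.exp (θ * Complex.I) =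
          Real.cos θ • Complex.I - Real.sin θ • (1 : ℂ) := by
        rw [hcs]
        simp only [Complex.real_smul, mul_one]
        linear_combination ((Real.sin θ : ℝ) : ℂ) * Complex.I_mul_I
      rw [this, map_sub, map_smul, map_smul]; simp
    rw [hD₁, hD₂]
    field_simp
    linear_combination (-((Real.sin θ : ℝ) : ℂ) * D Complex.I) * Complex.I_sq
  rw [key, integral_add (hi₁.const_mul _) (hi₂.const_mul _), integral_const_mul,
    integral_const_mul, hI₁, hI₂]
  ring

theorem integrable_rpow_mul_exp_neg_mul_rpow {p q b : ℝ} (hp : 1 ≤ p) (hq : -2 < q) (hb : 0 < b) :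
    Integrable fun x : ℂ => ‖x‖ ^ q * Real.exp (-b * ‖x‖ ^ p) := by
  -- The integral of a function that is not integrable would be zero.
  refine not_imp_comm.1 integral_undef ?_
  rw [Complex.integral_rpow_mul_exp_neg_mul_rpow hp hq hb]
  have : 0 < Real.Gamma ((q + 2) / p) := Real.Gamma_pos_of_pos (by apply div_pos <;> linarith)
  positivity

theorem locallyIntegrable_inv : LocallyIntegrable (fun t : ℂ => t⁻¹) := by
  have h1 := (integrable_rpow_mul_exp_neg_mul_rpow (p := 1) (q := -1) (b := 1) le_rfl
    (by norm_num) one_pos).locallyIntegrable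
  have h2 : LocallyIntegrable fun t : ℂ => Real.exp ‖t‖ * (‖t‖ ^ (-1 : ℝ) *
      Real.exp (-1 * ‖t‖ ^ (1 : ℝ))) := by
    intro x
    have h3 := (locallyIntegrableOn_univ.2 h1).continuousOn_mul (g := fun t : ℂ => Real.exp ‖t‖)
      (by fun_prop) isOpen_univ.isLocallyClosed
    exact (locallyIntegrableOn_univ.1 h3) x
  refine h2.mono measurable_inv.aestronglyMeasurable (ae_of_all _ fun t => ?_)
  rw [Real.rpow_one, Real.rpow_neg_one, mul_left_comm, ← Real.exp_add]
  simp

/-- The Cauchy transform solves `∂w/∂z̄ = u`, and is as smooth as `u`. -/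
theorem exists_wirtingerZBar_eq {u : ℂ → ℂ} (hu : ContDiff ℝ 2 u) (hc : HasCompactSupport u) :
    ∃ w : ℂ → ℂ, ContDiff ℝ 2 w ∧ wirtingerZBar w = u := by
  set M := ContinuousLinearMap.mul ℝ ℂ
  have hK : LocallyIntegrable (fun t : ℂ => (Real.pi : ℂ)⁻¹ * t⁻¹) :=
    locallyIntegrable_inv.smul ((Real.pi : ℂ)⁻¹)
  have hu1 : ContDiff ℝ 1 u := hu.of_le (by norm_num)
  refine ⟨convolution (fun t : ℂ => (Real.pi : ℂ)⁻¹ * t⁻¹) u M, ?_, ?_⟩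
  · exact hc.contDiff_convolution_right (n := 2) M hK hu
  funext x
  have hd := (hc.hasFDerivAt_convolution_right M hK hu1 x).fderiv
  have hexists : ∀ v, ConvolutionExistsAt (fun t : ℂ => (Real.pi : ℂ)⁻¹ * t⁻¹)
      (fun a => fderiv ℝ u a v) x M := fun v =>
    (hc.fderiv_apply ℝ v).convolutionExists_right M hK
      ((hu1.continuous_fderiv one_ne_zero).clm_apply continuous_const) x
  rw [wirtingerZBar, hd]
  have hcf := hu1.continuous_fderiv one_ne_zero
  have hv : ∀ v, (convolution (fun t : ℂ => (Real.pi : ℂ)⁻¹ * t⁻¹) (fderiv ℝ u)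
      (M.precompR ℂ)) x v = ∫ t : ℂ, (Real.pi : ℂ)⁻¹ * t⁻¹ * fderiv ℝ u (x - t) v := fun v =>
    convolution_precompR_apply M hK (hc.fderiv ℝ) hcf x v
  have h1 := integral_inv_mul_wirtingerZBar hu1 hc x
  have hpi : (Real.pi : ℂ) ≠ 0 := by exact_mod_cast Real.pi_ne_zero
  rw [hv, hv, ← integral_const_mul, ← integral_add, ← integral_const_mul]
  · calc _ = ∫ t : ℂ, (Real.pi : ℂ)⁻¹ * (t⁻¹ * wirtingerZBar u (x - t)) := by
          congr 1; ext t; rw [wirtingerZBar]; ring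
      _ = u x := by rw [integral_const_mul, h1]; field_simp
  · exact hexists 1
  · exact (hexists Complex.I).const_mul _

/-- A continuously differentiable function whose `z̄`-derivative is twice continuously
differentiable is so itself: near a point it differs by a holomorphic function from the Cauchy
transform of its localised derivative. -/
theorem contDiff_two_of_wirtingerZBar {g : ℂ → ℂ} (hg : ContDiff ℝ 1 g)
    (h : ContDiff ℝ 2 (wirtingerZBar g)) : ContDiff ℝ 2 g := by
  rw [contDiff_iff_contDiffAt]
  intro x
  -- Localise `∂g/∂z̄` to the disc of radius `2`, without changing it on the disc of radius `1`.
  let b : ContDiffBump x := ⟨1, 2, one_pos, one_lt_two⟩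
  have hb : ContDiff ℝ 2 fun y => ((b y : ℝ) : ℂ) := Complex.ofRealCLM.contDiff.comp b.contDiff
  obtain ⟨w, hw, hwu⟩ := exists_wirtingerZBar_eq (u := fun y => ((b y : ℝ) : ℂ) * wirtingerZBar g y)
    (hb.mul h) (by
      have : HasCompactSupport fun y => ((b y : ℝ) : ℂ) :=
        b.hasCompactSupport.comp_left Complex.ofReal_zero
      exact this.mul_right)
  have hgd := hg.differentiable one_ne_zero
  have hwd := hw.differentiable two_ne_zero
  have hhol : DifferentiableOn ℂ (g + (-1 : ℂ) • w) (Metric.ball x 1) := by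
    intro y hy
    refine (differentiableAt_of_wirtingerZBar_eq_zero ((hgd y).add ((hwd y).const_smul _)) ?_)
      |>.differentiableWithinAt
    rw [wirtingerZBar_add hgd (hwd.const_smul _), wirtingerZBar_smul _ hwd, hwu]
    have : b y = 1 := b.one_of_mem_closedBall (Metric.ball_subset_closedBall hy)
    simp [this]
  have h1 : ContDiffAt ℝ 2 (g + (-1 : ℂ) • w) x :=
    (hhol.analyticOnNhd Metric.isOpen_ball x
      (Metric.mem_ball_self one_pos)).contDiffAt.restrict_scalars ℝ
  have h2 := h1.add hw.contDiffAt
  convert h2 using 1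
  ext y
  simp

theorem contDiff_conj {f : ℂ → ℂ} {n : WithTop ℕ∞} (hf : ContDiff ℝ n f) :
    ContDiff ℝ n fun z => conj (f z) := Complex.conjCLE.contDiff.comp hf

/-- The regularity statement for `A⁺`, which is `∂/∂z̄` up to conjugation and multiplication by the
Gaussian weight. -/
theorem contDiff_two_of_creation {ν : ℝ} {g : ℂ → ℂ} (hg : ContDiff ℝ 1 g)
    (h : ContDiff ℝ 2 (creation ν g)) : ContDiff ℝ 2 g := by
  have hgd := hg.differentiable one_ne_zero
  have hwg : ContDiff ℝ 1 fun z => weight ν z * g z := (contDiff_weight ν).mul hg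
  have h1 : ContDiff ℝ 2 fun z => conj (weight ν z * g z) := by
    refine contDiff_two_of_wirtingerZBar (contDiff_conj hwg) ?_
    have : wirtingerZBar (fun z => conj (weight ν z * g z)) =
        fun z => conj (-(weight ν z * creation ν g z)) := by
      ext z
      rw [wirtingerZBar_conj (hwg.differentiable one_ne_zero z), wirtingerZ_weight_mul (hgd z)]
    rw [this]
    exact contDiff_conj ((contDiff_weight ν).mul h).neg
  -- `weight (-ν)` is the inverse of `weight ν`.
  have h2 : g = fun z => (weight (-ν) z) * conj (conj (weight ν z * g z)) := by
    ext z
    rw [Complex.conj_conj, ← mul_assoc, weight, weight, ← Complex.exp_add]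
    simp
  rw [h2]
  exact (contDiff_weight _).mul (contDiff_conj h1)

/-! ### Integration by parts against the Gaussian measure -/

theorem gaussMeasure_eq (ν : ℝ) : gaussMeasure ν =
    volume.withDensity fun z => ((Real.exp (-(ν * ‖z‖ ^ 2))).toNNReal : ENNReal) := rfl

theorem measurable_gaussDensity (ν : ℝ) :
    Measurable fun z : ℂ => (Real.exp (-(ν * ‖z‖ ^ 2))).toNNReal := by
  have : Continuous fun z : ℂ => Real.exp (-(ν * ‖z‖ ^ 2)) := by fun_prop
  exact this.measurable.real_toNNReal

theorem integral_gaussMeasure {ν : ℝ} (f : ℂ → ℂ) :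
    ∫ z, f z ∂(gaussMeasure ν) = ∫ z, weight ν z * f z := by
  rw [gaussMeasure_eq, integral_withDensity_eq_integral_smul (measurable_gaussDensity ν)]
  congr 1
  ext z
  rw [weight_eq, NNReal.smul_def, Real.coe_toNNReal _ (Real.exp_pos _).le, Complex.real_smul]

theorem integrable_gaussMeasure_iff {ν : ℝ} {E : Type*} [NormedAddCommGroup E] [NormedSpace ℝ E]
    {f : ℂ → E} : Integrable f (gaussMeasure ν) ↔
      Integrable fun z => Real.exp (-(ν * ‖z‖ ^ 2)) • f z := by
  rw [gaussMeasure_eq, integrable_withDensity_iff_integrable_smul (measurable_gaussDensity ν)]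
  refine integrable_congr (ae_of_all _ fun z => ?_)
  simp only [NNReal.smul_def, Real.coe_toNNReal _ (Real.exp_pos _).le]

theorem integrable_weight_mul_iff {ν : ℝ} {f : ℂ → ℂ} :
    (Integrable fun z => weight ν z * f z) ↔ Integrable f (gaussMeasure ν) := by
  rw [integrable_gaussMeasure_iff]
  refine integrable_congr (ae_of_all _ fun z => ?_)
  simp only [weight_eq, Complex.real_smul]

theorem memLp_gaussMeasure_iff {ν : ℝ} {f : ℂ → ℂ} (hf : Continuous f) :
    MemLp f 2 (gaussMeasure ν) ↔ Integrable fun z => Real.exp (-(ν * ‖z‖ ^ 2)) * ‖f z‖ ^ 2 := by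
  rw [memLp_two_iff_integrable_sq_norm hf.aestronglyMeasurable, integrable_gaussMeasure_iff]
  rfl

theorem memLp_conj {μ : Measure ℂ} {f : ℂ → ℂ} (hf : MemLp f 2 μ) :
    MemLp (fun z => conj (f z)) 2 μ := hf.star

theorem integrable_weight_mul_mul_conj {ν : ℝ} {f g : ℂ → ℂ} (hf : MemLp f 2 (gaussMeasure ν))
    (hg : MemLp g 2 (gaussMeasure ν)) : Integrable fun z => weight ν z * (f z * conj (g z)) :=
  integrable_weight_mul_iff.2 (hf.integrable_mul (memLp_conj hg))

theorem norm_wirtingerZBar_le (f : ℂ → ℂ) (z : ℂ) : ‖wirtingerZBar f z‖ ≤ ‖fderiv ℝ f z‖ := by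
  have h1 : ‖fderiv ℝ f z 1‖ ≤ ‖fderiv ℝ f z‖ := by
    simpa using (fderiv ℝ f z).le_opNorm 1
  have h2 : ‖Complex.I * fderiv ℝ f z Complex.I‖ ≤ ‖fderiv ℝ f z‖ := by
    simpa using (fderiv ℝ f z).le_opNorm Complex.I
  have h3 := norm_add_le (fderiv ℝ f z 1) (Complex.I * fderiv ℝ f z Complex.I)
  rw [wirtingerZBar, norm_mul]
  norm_num
  linarith

/-- Cutoff functions equal to `1` on the disc of radius `k`, with derivatives of order `1 / k`. -/
theorem exists_cutoff : ∃ (C : ℝ) (χ : ℕ → ℂ → ℝ), 0 ≤ C ∧ ∀ k,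
    ContDiff ℝ 2 (fun z => (χ k z : ℂ)) ∧ HasCompactSupport (fun z => (χ k z : ℂ)) ∧
    (∀ z, 0 ≤ χ k z ∧ χ k z ≤ 1) ∧ (∀ z, ‖z‖ ≤ k → χ k z = 1) ∧
    ∀ z, ‖wirtingerZBar (fun z => (χ k z : ℂ)) z‖ ≤ C / (k + 1) := by
  let b : ContDiffBump (0 : ℂ) := ⟨1, 2, one_pos, one_lt_two⟩
  have hb : ContDiff ℝ 2 fun y => ((b y : ℝ) : ℂ) := Complex.ofRealCLM.contDiff.comp b.contDiff
  have hbc : HasCompactSupport fun y => ((b y : ℝ) : ℂ) :=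
    b.hasCompactSupport.comp_left Complex.ofReal_zero
  obtain ⟨C, hC⟩ := (hbc.fderiv ℝ).exists_bound_of_continuous (hb.continuous_fderiv two_ne_zero)
  refine ⟨C, fun k z => b (((k : ℝ) + 1)⁻¹ • z), (norm_nonneg _).trans (hC 0), fun k => ?_⟩
  have hk : (0 : ℝ) < (k + 1 : ℝ)⁻¹ := by positivity
  refine ⟨hb.comp (contDiff_const_smul _), hbc.comp_smul hk.ne', fun z => ⟨b.nonneg, b.le_one⟩,
    fun z hz => b.one_of_mem_closedBall ?_, fun z => (norm_wirtingerZBar_le _ z).trans ?_⟩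
  · rw [mem_closedBall_zero_iff, norm_smul, Real.norm_of_nonneg hk.le,
      inv_mul_le_iff₀ (by positivity)]
    show ‖z‖ ≤ (k + 1) * 1
    linarith
  · have : fderiv ℝ (fun z => ((b (((k : ℝ) + 1)⁻¹ • z) : ℝ) : ℂ)) z =
        ((k : ℝ) + 1)⁻¹ • fderiv ℝ (fun y => ((b y : ℝ) : ℂ)) (((k : ℝ) + 1)⁻¹ • z) :=
      fderiv_comp_smul (f := fun y => ((b y : ℝ) : ℂ)) _
    rw [this, norm_smul, Real.norm_of_nonneg hk.le, div_eq_inv_mul]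
    exact mul_le_mul_of_nonneg_left (hC _) hk.le

theorem hasCompactSupport_wirtingerZBar {u : ℂ → ℂ} (hc : HasCompactSupport u) :
    HasCompactSupport (wirtingerZBar u) := by
  refine HasCompactSupport.mul_left (f := fun _ => (1 / 2 : ℂ)) ?_
  exact (hc.fderiv_apply ℝ 1).add ((hc.fderiv_apply ℝ Complex.I).mul_left)

theorem integral_wirtingerZBar_of_hasCompactSupport {u : ℂ → ℂ} (hu : ContDiff ℝ 1 u)
    (hc : HasCompactSupport u) : ∫ z, wirtingerZBar u z = 0 := by
  have hud := hu.differentiable one_ne_zero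
  have hcont : ∀ v, Continuous fun z => fderiv ℝ u z v := fun v =>
    (hu.continuous_fderiv one_ne_zero).clm_apply continuous_const
  have hint : ∀ v, Integrable fun z => fderiv ℝ u z v := fun v =>
    (hcont v).integrable_of_hasCompactSupport (hc.fderiv_apply ℝ v)
  have h0 : ∀ v, ∫ z, fderiv ℝ u z v = 0 := by
    intro v
    have := integral_mul_fderiv_eq_neg_fderiv_mul_of_integrable (μ := volume)
      (f := fun _ : ℂ => (1 : ℂ)) (g := u) (v := v) (by simp) (by simpa using hint v)
      (by simpa using hu.continuous.integrable_of_hasCompactSupport hc)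
      (fun x _ => differentiableAt_const _) (fun x _ => hud x)
    simpa using this
  have : wirtingerZBar u =
      fun z => (1 / 2) * (fderiv ℝ u z 1 + Complex.I * fderiv ℝ u z Complex.I) := rfl
  rw [this, integral_const_mul, integral_add (hint 1) ((hint _).const_mul _), integral_const_mul,
    h0, h0]
  simp

/-- No decay of the remaining first derivative is needed: the cutoff error only involves `u`. -/
theorem integral_wirtingerZBar_of_integrable {u : ℂ → ℂ} (hu : ContDiff ℝ 1 u)
    (hi : Integrable u) (hi' : Integrable (wirtingerZBar u)) : ∫ z, wirtingerZBar u z = 0 := by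
  obtain ⟨C, χ, hC, hχ⟩ := exists_cutoff
  have hud := hu.differentiable one_ne_zero
  have hlim : Filter.Tendsto (fun k => ∫ z, (χ k z : ℂ) * wirtingerZBar u z) Filter.atTop
      (nhds (∫ z, wirtingerZBar u z)) := by
    refine tendsto_integral_of_dominated_convergence (fun z => ‖wirtingerZBar u z‖)
      (fun k => ((hχ k).1.continuous.aestronglyMeasurable.mul hi'.aestronglyMeasurable)) hi'.norm
      (fun k => ae_of_all _ fun z => ?_) (ae_of_all _ fun z => ?_)
    · rw [norm_mul, Complex.norm_real, Real.norm_of_nonneg ((hχ k).2.2.1 z).1]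
      exact mul_le_of_le_one_left (norm_nonneg _) ((hχ k).2.2.1 z).2
    · refine tendsto_const_nhds.congr' ?_
      obtain ⟨N, hN⟩ := exists_nat_ge ‖z‖
      filter_upwards [Filter.eventually_ge_atTop N] with k hk
      rw [(hχ k).2.2.2.1 z (hN.trans (by exact_mod_cast hk))]
      simp
  have heq : ∀ k, ∫ z, (χ k z : ℂ) * wirtingerZBar u z =
      -∫ z, wirtingerZBar (fun z => (χ k z : ℂ)) z * u z := by
    intro k
    obtain ⟨h1, h2, -⟩ := hχ k
    have hd := h1.differentiable two_ne_zero
    have h3 := integral_wirtingerZBar_of_hasCompactSupport ((h1.of_le one_le_two).mul hu)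
      h2.mul_right
    have h4 : wirtingerZBar (fun z => (χ k z : ℂ) * u z) = fun z =>
        wirtingerZBar (fun z => (χ k z : ℂ)) z * u z + (χ k z : ℂ) * wirtingerZBar u z := by
      ext z; rw [wirtingerZBar_mul (hd z) (hud z)]
    rw [h4, integral_add] at h3
    · linear_combination h3
    · exact (((contDiff_wirtingerZBar h1).continuous.mul
        hu.continuous).integrable_of_hasCompactSupport
        (hasCompactSupport_wirtingerZBar h2).mul_right)
    · exact ((h1.continuous.mul (contDiff_wirtingerZBar_of_le hu (m := 0)
        (by simp)).continuous).integrable_of_hasCompactSupport h2.mul_right)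
  have hzero : Filter.Tendsto (fun k => ∫ z, (χ k z : ℂ) * wirtingerZBar u z) Filter.atTop
      (nhds 0) := by
    have hC0 : Filter.Tendsto (fun k : ℕ => C * (1 / ((k : ℝ) + 1)) * ∫ z, ‖u z‖) Filter.atTop
        (nhds 0) := by
      simpa using ((tendsto_one_div_add_atTop_nhds_zero_nat (𝕜 := ℝ)).const_mul C).mul_const
        (∫ z, ‖u z‖)
    refine squeeze_zero_norm (fun k => ?_) hC0
    rw [heq, norm_neg, ← integral_const_mul]
    refine norm_integral_le_of_norm_le (hi.norm.const_mul _) (ae_of_all _ fun z => ?_)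
    rw [norm_mul, mul_one_div]
    exact mul_le_mul_of_nonneg_right ((hχ k).2.2.2.2 z) (norm_nonneg _)
  exact tendsto_nhds_unique hlim hzero

/-- The operators `∂/∂z̄` and `A⁺` are adjoint to each other in `L²(ℂ, e^{-ν|z|²} dλ)`. -/
theorem innerProd_wirtingerZBar {ν : ℝ} {f g : ℂ → ℂ} (hf : ContDiff ℝ 1 f) (hg : ContDiff ℝ 1 g)
    (hf2 : MemLp f 2 (gaussMeasure ν)) (hg2 : MemLp g 2 (gaussMeasure ν))
    (hAf : MemLp (wirtingerZBar f) 2 (gaussMeasure ν))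
    (hAg : MemLp (creation ν g) 2 (gaussMeasure ν)) :
    innerProd ν (wirtingerZBar f) g = innerProd ν f (creation ν g) := by
  have hu : ContDiff ℝ 1 fun z => f z * conj (weight ν z * g z) :=
    hf.mul (contDiff_conj ((contDiff_weight ν).mul hg))
  have hd : wirtingerZBar (fun z => f z * conj (weight ν z * g z)) = fun z =>
      weight ν z * (wirtingerZBar f z * conj (g z)) -
        weight ν z * (f z * conj (creation ν g z)) := by
    ext z
    rw [wirtingerZBar_mul_conj_mul_weight (hf.differentiable one_ne_zero z)
      (hg.differentiable one_ne_zero z), mul_sub]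
  have h1 := integrable_weight_mul_mul_conj hAf hg2
  have h2 := integrable_weight_mul_mul_conj hf2 hAg
  have h0 := integral_wirtingerZBar_of_integrable hu
    ((integrable_weight_mul_mul_conj hf2 hg2).congr (ae_of_all _ fun z => by
      simp only [map_mul, conj_weight]; ring)) (by rw [hd]; exact h1.sub h2)
  rw [hd, integral_sub h1 h2, sub_eq_zero] at h0
  rw [innerProd, innerProd, integral_gaussMeasure, integral_gaussMeasure, h0]

/-- An energy estimate of Caccioppoli type: the cutoff identity obtained by integrating a total
derivative bounds the norm of `u` by that of `f`. -/
theorem memLp_of_cutoff_estimate {ν l : ℝ} {f u : ℂ → ℂ} (hf : Continuous f) (hu : Continuous u)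
    (hf2 : MemLp f 2 (gaussMeasure ν))
    (H : ∀ χ : ℂ → ℝ, ContDiff ℝ 2 (fun z => (χ z : ℂ)) → HasCompactSupport (fun z => (χ z : ℂ)) →
      (∀ z, 0 ≤ χ z) → ∃ V : ℂ → ℂ, ContDiff ℝ 1 V ∧ HasCompactSupport V ∧ ∀ z,
        Real.exp (-(ν * ‖z‖ ^ 2)) * (χ z ^ 2 * ‖u z‖ ^ 2) ≤ (wirtingerZBar V z).re +
          Real.exp (-(ν * ‖z‖ ^ 2)) * (l * (χ z ^ 2 * ‖f z‖ ^ 2) +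
            2 * (χ z * ‖u z‖) * (‖wirtingerZBar (fun z => (χ z : ℂ)) z‖ * ‖f z‖))) :
    MemLp u 2 (gaussMeasure ν) := by
  rw [memLp_gaussMeasure_iff hf] at hf2
  rw [memLp_gaussMeasure_iff hu]
  obtain ⟨C, χ, hC, hχ⟩ := exists_cutoff
  set W : ℂ → ℝ := fun z => Real.exp (-(ν * ‖z‖ ^ 2)) with hW
  have hWc : Continuous W := by fun_prop
  have hW0 : ∀ z, 0 < W z := fun z => Real.exp_pos _
  set N := ∫ z, W z * ‖f z‖ ^ 2 with hN
  have hcover : AECover (volume : Measure ℂ) Filter.atTop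
      (fun k : ℕ => Metric.closedBall (0 : ℂ) k) :=
    aecover_closedBall tendsto_natCast_atTop_atTop
  refine hcover.integrable_of_integral_bounded_of_nonneg_ae (2 * ((|l| + 2 * C ^ 2) * N))
    (fun k => ?_) (ae_of_all _ fun z => by positivity) (Filter.Eventually.of_forall fun k => ?_)
  · exact (Continuous.continuousOn (by fun_prop)).integrableOn_compact
      (isCompact_closedBall _ _)
  obtain ⟨h1, h2, h01, hone, hder⟩ := hχ k
  obtain ⟨V, hV, hVc, hle⟩ := H (χ k) h1 h2 fun z => (h01 z).1
  have hχc : Continuous (χ k) := by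
    have := Complex.continuous_re.comp h1.continuous
    simpa [Function.comp_def] using this
  have hχs : HasCompactSupport (χ k) := by
    have := h2.comp_left Complex.zero_re
    simpa [Function.comp_def] using this
  have hi1 : Integrable fun z => W z * (χ k z ^ 2 * ‖u z‖ ^ 2) := by
    refine Continuous.integrable_of_hasCompactSupport (by fun_prop) ?_
    have : (fun z => W z * (χ k z ^ 2 * ‖u z‖ ^ 2)) =
      fun z => χ k z * (χ k z * (W z * ‖u z‖ ^ 2)) := by ext z; ring
    rw [this]
    exact hχs.mul_right
  have hi2 : Integrable (wirtingerZBar V) :=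
    (contDiff_wirtingerZBar_of_le hV (m := 0) (by simp)).continuous.integrable_of_hasCompactSupport
      (hasCompactSupport_wirtingerZBar hVc)
  have hr : Integrable fun z => (wirtingerZBar V z).re := hi2.re
  have hre : ∫ z, (wirtingerZBar V z).re = 0 := by
    have h := integral_wirtingerZBar_of_hasCompactSupport hV hVc
    have h' : ∫ z, (wirtingerZBar V z).re = (∫ z, wirtingerZBar V z).re := integral_re hi2
    rw [h', h, Complex.zero_re]
  have hpt : ∀ z, W z * (χ k z ^ 2 * ‖u z‖ ^ 2) ≤
      2 * (wirtingerZBar V z).re + 2 * ((|l| + 2 * C ^ 2) * (W z * ‖f z‖ ^ 2)) := by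
    intro z
    have hd : ‖wirtingerZBar (fun z => (χ k z : ℂ)) z‖ ≤ C :=
      (hder z).trans (div_le_self hC (by linarith [Nat.cast_nonneg (α := ℝ) k]))
    have hχ2 : χ k z ^ 2 ≤ 1 := pow_le_one₀ (h01 z).1 (h01 z).2
    set d := ‖wirtingerZBar (fun z => (χ k z : ℂ)) z‖ with hd'
    have hd0 : 0 ≤ d := norm_nonneg _
    have e1 : l * (χ k z ^ 2 * ‖f z‖ ^ 2) ≤ |l| * ‖f z‖ ^ 2 := by
      refine (mul_le_mul_of_nonneg_right (le_abs_self l) (by positivity)).trans ?_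
      exact mul_le_mul_of_nonneg_left (mul_le_of_le_one_left (by positivity) hχ2) (abs_nonneg l)
    -- Young's inequality, with half of `χ² ‖u‖²` to be absorbed on the left.
    have e2 : 2 * (χ k z * ‖u z‖) * (d * ‖f z‖) ≤
        (χ k z ^ 2 * ‖u z‖ ^ 2) / 2 + 2 * (C ^ 2 * ‖f z‖ ^ 2) := by
      have e3 : d ^ 2 * ‖f z‖ ^ 2 ≤ C ^ 2 * ‖f z‖ ^ 2 :=
        mul_le_mul_of_nonneg_right (pow_le_pow_left₀ hd0 hd 2) (by positivity)
      nlinarith [sq_nonneg (χ k z * ‖u z‖ - 2 * (d * ‖f z‖))]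
    have e4 := hle z
    have e5 := mul_le_mul_of_nonneg_left (add_le_add e1 e2) (hW0 z).le
    simp only [hW] at e4 e5 ⊢
    linarith
  calc ∫ z in Metric.closedBall (0 : ℂ) k, W z * ‖u z‖ ^ 2
      = ∫ z in Metric.closedBall (0 : ℂ) k, W z * (χ k z ^ 2 * ‖u z‖ ^ 2) := by
        refine setIntegral_congr_fun measurableSet_closedBall fun z hz => ?_
        simp [hone z (by simpa using hz)]
    _ ≤ ∫ z, W z * (χ k z ^ 2 * ‖u z‖ ^ 2) :=
        setIntegral_le_integral hi1 (ae_of_all _ fun z => by positivity)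
    _ ≤ ∫ z, (2 * (wirtingerZBar V z).re + 2 * ((|l| + 2 * C ^ 2) * (W z * ‖f z‖ ^ 2))) :=
        integral_mono hi1 ((hr.const_mul _).add ((hf2.const_mul _).const_mul _)) hpt
    _ = 2 * ((|l| + 2 * C ^ 2) * N) := by
        rw [integral_add (hr.const_mul _) ((hf2.const_mul _).const_mul _), integral_const_mul,
          integral_const_mul, integral_const_mul, hre, mul_zero, zero_add]

theorem wirtingerZBar_sq_mul {χ f : ℂ → ℂ} {z : ℂ} (hχ : DifferentiableAt ℝ χ z)
    (hf : DifferentiableAt ℝ f z) : wirtingerZBar (fun z => χ z * (χ z * f z)) z =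
      χ z ^ 2 * wirtingerZBar f z + 2 * χ z * wirtingerZBar χ z * f z := by
  rw [wirtingerZBar_mul hχ (hχ.fun_mul hf), wirtingerZBar_mul hχ hf]
  ring

/-- The pointwise bound behind the energy estimates: `a` stands for `u`, `b` for `f`, `d` for
`∂χ/∂z̄` and `q` for the cross term. -/
theorem energy_re_le {w χ l : ℝ} (hw : 0 ≤ w) (hχ : 0 ≤ χ) (a b d q : ℂ)
    (hq : ‖q‖ = ‖a‖ * ‖b‖) :
    w * (χ ^ 2 * ‖a‖ ^ 2) ≤ ((w : ℂ) * ((χ : ℂ) ^ 2 * (a * conj a) -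
      (χ : ℂ) ^ 2 * (l * (b * conj b)) + 2 * χ * d * q)).re +
      w * (l * (χ ^ 2 * ‖b‖ ^ 2) + 2 * (χ * ‖a‖) * (‖d‖ * ‖b‖)) := by
  have h1 : (χ : ℂ) ^ 2 * (a * conj a) - (χ : ℂ) ^ 2 * (l * (b * conj b)) + 2 * χ * d * q =
      ((χ ^ 2 * ‖a‖ ^ 2 - χ ^ 2 * (l * ‖b‖ ^ 2) : ℝ) : ℂ) + 2 * χ * d * q := by
    rw [Complex.mul_conj, Complex.mul_conj, Complex.normSq_eq_norm_sq, Complex.normSq_eq_norm_sq]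
    push_cast
    ring
  have h2 : -(2 * (χ * ‖a‖) * (‖d‖ * ‖b‖)) ≤ (2 * (χ : ℂ) * d * q).re := by
    have h3 := (abs_le.1 (Complex.abs_re_le_norm (2 * (χ : ℂ) * d * q))).1
    have h4 : ‖2 * (χ : ℂ) * d * q‖ = 2 * (χ * ‖a‖) * (‖d‖ * ‖b‖) := by
      rw [norm_mul, norm_mul, norm_mul, hq, Complex.norm_real, Real.norm_of_nonneg hχ,
        RCLike.norm_ofNat]
      ring
    rwa [h4] at h3
  rw [h1, Complex.re_ofReal_mul, Complex.add_re, Complex.ofReal_re, ← mul_add]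
  refine mul_le_mul_of_nonneg_left ?_ hw
  linarith

/-- An eigenfunction of `A⁺ ∂/∂z̄` in `L²` has its `z̄`-derivative in `L²`. -/
theorem memLp_wirtingerZBar {ν l : ℝ} {f : ℂ → ℂ} (hf : ContDiff ℝ 2 f)
    (hf2 : MemLp f 2 (gaussMeasure ν))
    (h : creation ν (wirtingerZBar f) = (l : ℂ) • f) :
    MemLp (wirtingerZBar f) 2 (gaussMeasure ν) := by
  have hu := contDiff_wirtingerZBar hf
  refine memLp_of_cutoff_estimate (l := l) hf.continuous hu.continuous hf2 fun χ hχ hχc hχ0 =>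
    ⟨fun z => χ z * (χ z * f z) * conj (weight ν z * wirtingerZBar f z), ?_, ?_, fun z => ?_⟩
  · exact (((hχ.mul (hχ.mul hf)).of_le one_le_two).mul
      (contDiff_conj ((contDiff_weight ν).mul hu)))
  · exact HasCompactSupport.mul_right (HasCompactSupport.mul_right hχc)
  have hχd := hχ.differentiable two_ne_zero z
  have hfd := hf.differentiable two_ne_zero z
  rw [wirtingerZBar_mul_conj_mul_weight (hχd.fun_mul (hχd.fun_mul hfd))
    (hu.differentiable one_ne_zero z), wirtingerZBar_sq_mul hχd hfd, h, weight_eq]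
  have := energy_re_le (l := l) (Real.exp_pos (-(ν * ‖z‖ ^ 2))).le (hχ0 z) (wirtingerZBar f z) (f z)
    (wirtingerZBar (fun z => (χ z : ℂ)) z) (f z * conj (wirtingerZBar f z))
    (by rw [norm_mul, RCLike.norm_conj, mul_comm])
  refine this.trans (le_of_eq ?_)
  congr 3
  simp only [Pi.smul_apply, smul_eq_mul, map_mul, Complex.conj_ofReal]
  ring

/-- An eigenfunction of `(∂/∂z̄) A⁺` in `L²` is mapped into `L²` by `A⁺`. -/
theorem memLp_creation {ν l : ℝ} {f : ℂ → ℂ} (hf : ContDiff ℝ 2 f)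
    (hf2 : MemLp f 2 (gaussMeasure ν))
    (h : wirtingerZBar (creation ν f) = (l : ℂ) • f) :
    MemLp (creation ν f) 2 (gaussMeasure ν) := by
  have hu : ContDiff ℝ 1 (creation ν f) := contDiff_creation hf (by norm_num)
  have hf1 : ContDiff ℝ 1 f := hf.of_le one_le_two
  refine memLp_of_cutoff_estimate (l := l) hf.continuous hu.continuous hf2 fun χ hχ hχc hχ0 =>
    ⟨fun z => (-1 : ℂ) * (χ z * (χ z * creation ν f z) * conj (weight ν z * f z)), ?_, ?_,
      fun z => ?_⟩
  · have hχ1 := hχ.of_le one_le_two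
    exact contDiff_const.mul ((hχ1.mul (hχ1.mul hu)).mul
      (contDiff_conj ((contDiff_weight ν).mul hf1)))
  · exact (HasCompactSupport.mul_right (HasCompactSupport.mul_right hχc)).mul_left
  have hχd := hχ.differentiable two_ne_zero z
  have hud := hu.differentiable one_ne_zero z
  have hfd := hf.differentiable two_ne_zero z
  have hc : DifferentiableAt ℝ (fun w => conj (weight ν w * f w)) z :=
    (contDiff_conj ((contDiff_weight ν (n := 1)).mul hf1)).differentiable one_ne_zero z
  rw [wirtingerZBar_mul (differentiableAt_const _) ((hχd.fun_mul (hχd.fun_mul hud)).fun_mul hc),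
    wirtingerZBar_mul_conj_mul_weight (hχd.fun_mul (hχd.fun_mul hud)) hfd,
    wirtingerZBar_sq_mul hχd hud, h, weight_eq]
  have := energy_re_le (l := l) (Real.exp_pos (-(ν * ‖z‖ ^ 2))).le (hχ0 z) (creation ν f z) (f z)
    (wirtingerZBar (fun z => (χ z : ℂ)) z) (-(creation ν f z * conj (f z)))
    (by rw [norm_neg, norm_mul, RCLike.norm_conj])
  refine this.trans (le_of_eq ?_)
  congr 3
  have h0 : wirtingerZBar (fun _ => (-1 : ℂ)) z = 0 := by simp [wirtingerZBar]
  rw [h0]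
  simp only [Pi.smul_apply, smul_eq_mul]
  ring

/-! ### The ladder of generalized Bargmann–Fock spaces -/

theorem mem_fockSpace_iff {ν : ℝ} {n : ℕ} {f : ℂ → ℂ} : f ∈ fockSpace ν n ↔
    ContDiff ℝ 2 f ∧ MemLp f 2 (gaussMeasure ν) ∧
      creation ν (wirtingerZBar f) = ((ν * n : ℝ) : ℂ) • f := by
  rw [funext_iff]
  push_cast
  rfl

theorem creation_smul {ν : ℝ} (c : ℂ) {f : ℂ → ℂ} (hf : Differentiable ℝ f) :
    creation ν (c • f) = c • creation ν f := by
  ext z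
  simp only [creation, wirtingerZ_smul c hf, Pi.smul_apply, smul_eq_mul]
  ring

theorem differentiable_of_mem {ν : ℝ} {n : ℕ} {f : ℂ → ℂ} (hf : f ∈ fockSpace ν n) :
    Differentiable ℝ f := hf.1.differentiable two_ne_zero

/-- The annihilation operator `∂/∂z̄` lowers the level. As `f` is only assumed to be `C²`, the
regularity of `∂f/∂z̄` comes from `A⁺ ∂f/∂z̄ = ν (n + 1) f`. -/
theorem wirtingerZBar_mem {ν : ℝ} {n : ℕ} {f : ℂ → ℂ} (hf : f ∈ fockSpace ν (n + 1)) :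
    wirtingerZBar f ∈ fockSpace ν n := by
  obtain ⟨h1, h2, h3⟩ := mem_fockSpace_iff.1 hf
  have hA := contDiff_two_of_creation (contDiff_wirtingerZBar h1)
    (by rw [h3]; exact contDiff_const.smul h1)
  refine mem_fockSpace_iff.2 ⟨hA, memLp_wirtingerZBar h1 h2 h3, ?_⟩
  -- `A⁺ ∂(∂f/∂z̄)/∂z̄ = ∂(A⁺ ∂f/∂z̄)/∂z̄ - ν ∂f/∂z̄ = ν (n + 1) ∂f/∂z̄ - ν ∂f/∂z̄`.
  have h4 := wirtingerZBar_creation (ν := ν) hA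
  rw [h3, wirtingerZBar_smul _ (h1.differentiable two_ne_zero)] at h4
  ext z
  have h5 := congrFun h4 z
  simp only [Pi.add_apply, Pi.smul_apply, smul_eq_mul] at h5 ⊢
  push_cast at h5 ⊢
  linear_combination -h5

theorem wirtingerZBar_creation_of_mem {ν : ℝ} {n : ℕ} {f : ℂ → ℂ} (hf : f ∈ fockSpace ν n) :
    wirtingerZBar (creation ν f) = ((ν * (n + 1 : ℕ) : ℝ) : ℂ) • f := by
  obtain ⟨h1, h2, h3⟩ := mem_fockSpace_iff.1 hf
  rw [wirtingerZBar_creation h1, h3, ← add_smul]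
  push_cast
  ring_nf

/-- The creation operator raises the level; the regularity of `A⁺ f` comes from
`∂(A⁺ f)/∂z̄ = ν (n + 1) f`. -/
theorem creation_mem {ν : ℝ} {n : ℕ} {f : ℂ → ℂ} (hf : f ∈ fockSpace ν n) :
    creation ν f ∈ fockSpace ν (n + 1) := by
  have h := wirtingerZBar_creation_of_mem hf
  have h1 : ContDiff ℝ 1 (creation ν f) := contDiff_creation hf.1 (by norm_num)
  refine mem_fockSpace_iff.2 ⟨contDiff_two_of_wirtingerZBar h1
    (by rw [h]; exact contDiff_const.smul hf.1),
    memLp_creation hf.1 hf.2.1 h, ?_⟩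
  rw [h, creation_smul _ (differentiable_of_mem hf)]

theorem creation_wirtingerZBar_of_mem {ν : ℝ} {n : ℕ} {f : ℂ → ℂ} (hf : f ∈ fockSpace ν n) :
    creation ν (wirtingerZBar f) = ((ν * n : ℝ) : ℂ) • f := (mem_fockSpace_iff.1 hf).2.2

/-- The lowest space consists of holomorphic functions: `‖∂f/∂z̄‖² = ⟨f, A⁺ ∂f/∂z̄⟩ = 0`. -/
theorem wirtingerZBar_eq_zero {ν : ℝ} {f : ℂ → ℂ} (hf : f ∈ fockSpace ν 0) :
    wirtingerZBar f = 0 := by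
  obtain ⟨h1, h2, h3⟩ := mem_fockSpace_iff.1 hf
  have hA := contDiff_wirtingerZBar h1
  have hA2 := memLp_wirtingerZBar h1 h2 h3
  have h0 : creation ν (wirtingerZBar f) = 0 := by simpa using h3
  have h := innerProd_wirtingerZBar (h1.of_le one_le_two) hA h2 hA2 hA2
    (by rw [h0]; exact MemLp.zero)
  rw [h0] at h
  have h4 : ∫ z, weight ν z * (wirtingerZBar f z * conj (wirtingerZBar f z)) = 0 := by
    rw [← integral_gaussMeasure]
    simpa [innerProd] using h
  have h5 : ∫ z, Real.exp (-(ν * ‖z‖ ^ 2)) * ‖wirtingerZBar f z‖ ^ 2 = 0 := by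
    have : ∀ z, weight ν z * (wirtingerZBar f z * conj (wirtingerZBar f z)) =
        ((Real.exp (-(ν * ‖z‖ ^ 2)) * ‖wirtingerZBar f z‖ ^ 2 : ℝ) : ℂ) := fun z => by
      rw [Complex.mul_conj, Complex.normSq_eq_norm_sq, weight_eq]
      push_cast
      rfl
    simp only [this] at h4
    rw [integral_complex_ofReal] at h4
    exact_mod_cast h4
  have hAc := hA.continuous
  rw [integral_eq_zero_iff_of_nonneg (fun z => by positivity)
    ((memLp_gaussMeasure_iff hAc).1 hA2)] at h5
  have h6 := (Continuous.ae_eq_iff_eq volume (by fun_prop) continuous_zero).1 h5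
  ext z
  have h7 := congrFun h6 z
  simpa [Real.exp_ne_zero] using h7

theorem differentiable_complex_of_mem {ν : ℝ} {f : ℂ → ℂ} (hf : f ∈ fockSpace ν 0) :
    Differentiable ℂ f := fun z =>
  differentiableAt_of_wirtingerZBar_eq_zero (differentiable_of_mem hf z)
    (by rw [wirtingerZBar_eq_zero hf]; rfl)

theorem mem_fockSpace_zero {ν : ℝ} {f : ℂ → ℂ} (hf : Differentiable ℂ f)
    (hf2 : MemLp f 2 (gaussMeasure ν)) : f ∈ fockSpace ν 0 := by
  have h : wirtingerZBar f = 0 := by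
    ext z
    exact wirtingerZBar_of_hasDerivAt (hf z).hasDerivAt
  refine mem_fockSpace_iff.2 ⟨(hf.contDiff (n := 2)).restrict_scalars ℝ, hf2, ?_⟩
  rw [h]
  ext z
  simp [creation, wirtingerZ]

theorem innerProd_wirtingerZBar_of_mem {ν : ℝ} {n : ℕ} {f g : ℂ → ℂ} (hf : f ∈ fockSpace ν (n + 1))
    (hg : g ∈ fockSpace ν n) :
    innerProd ν (wirtingerZBar f) g = innerProd ν f (creation ν g) :=
  innerProd_wirtingerZBar (hf.1.of_le one_le_two) (hg.1.of_le one_le_two) hf.2.1 hg.2.1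
    (wirtingerZBar_mem hf).2.1 (creation_mem hg).2.1

theorem innerProd_smul_left {ν : ℝ} (c : ℂ) (f g : ℂ → ℂ) :
    innerProd ν (c • f) g = c * innerProd ν f g := by
  simp only [innerProd, Pi.smul_apply, smul_eq_mul, mul_assoc, integral_const_mul]

theorem innerProd_smul_right {ν : ℝ} (c : ℂ) (f g : ℂ → ℂ) :
    innerProd ν f (c • g) = conj c * innerProd ν f g := by
  simp only [innerProd, Pi.smul_apply, smul_eq_mul, map_mul, ← integral_const_mul]
  congr 1
  ext z
  ring

theorem iterate_wirtingerZBar_mem {ν : ℝ} {n : ℕ} {f : ℂ → ℂ} (hf : f ∈ fockSpace ν n) :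
    wirtingerZBar^[n] f ∈ fockSpace ν 0 := by
  induction n generalizing f with
  | zero => exact hf
  | succ n ih => exact ih (wirtingerZBar_mem hf)

theorem iterate_creation_mem {ν : ℝ} {f : ℂ → ℂ} (hf : f ∈ fockSpace ν 0) (n : ℕ) :
    (creation ν)^[n] f ∈ fockSpace ν n := by
  induction n with
  | zero => exact hf
  | succ n ih =>
    rw [Function.iterate_succ_apply']
    exact creation_mem ih

theorem iterate_wirtingerZBar_smul {ν : ℝ} {n : ℕ} (c : ℂ) {f : ℂ → ℂ} (hf : f ∈ fockSpace ν n) :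
    wirtingerZBar^[n] (c • f) = c • wirtingerZBar^[n] f := by
  induction n generalizing f with
  | zero => rfl
  | succ n ih =>
    rw [Function.iterate_succ_apply, wirtingerZBar_smul c (differentiable_of_mem hf),
      ih (wirtingerZBar_mem hf), Function.iterate_succ_apply]

theorem iterate_creation_smul {ν : ℝ} (c : ℂ) {f : ℂ → ℂ} (hf : f ∈ fockSpace ν 0) (n : ℕ) :
    (creation ν)^[n] (c • f) = c • (creation ν)^[n] f := by
  induction n with
  | zero => rfl
  | succ n ih =>
    rw [Function.iterate_succ_apply', ih,
      creation_smul c (differentiable_of_mem (iterate_creation_mem hf n)),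
      Function.iterate_succ_apply']

/-- The squared norm `n! ν^n` of the `n`-fold creation operator on the lowest space. -/
def ladderConst (ν : ℝ) (n : ℕ) : ℝ := n.factorial * ν ^ n

theorem ladderConst_succ (ν : ℝ) (n : ℕ) :
    ladderConst ν (n + 1) = ν * (n + 1 : ℕ) * ladderConst ν n := by
  simp only [ladderConst, Nat.factorial_succ]
  push_cast
  ring

theorem iterate_wirtingerZBar_iterate_creation {ν : ℝ} {f : ℂ → ℂ} (hf : f ∈ fockSpace ν 0)
    (n : ℕ) : wirtingerZBar^[n] ((creation ν)^[n] f) = (ladderConst ν n : ℂ) • f := by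
  induction n with
  | zero => simp [ladderConst]
  | succ n ih =>
    have hm := iterate_creation_mem hf n
    rw [Function.iterate_succ_apply, Function.iterate_succ_apply',
      wirtingerZBar_creation_of_mem hm, iterate_wirtingerZBar_smul _ hm, ih, smul_smul,
      ladderConst_succ]
    simp only [Complex.ofReal_mul]

theorem iterate_creation_iterate_wirtingerZBar {ν : ℝ} {n : ℕ} {f : ℂ → ℂ}
    (hf : f ∈ fockSpace ν n) :
    (creation ν)^[n] (wirtingerZBar^[n] f) = (ladderConst ν n : ℂ) • f := by
  induction n generalizing f with
  | zero => simp [ladderConst]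
  | succ n ih =>
    have hm := wirtingerZBar_mem hf
    rw [Function.iterate_succ_apply', Function.iterate_succ_apply, ih hm,
      creation_smul _ (differentiable_of_mem hm), creation_wirtingerZBar_of_mem hf, smul_smul,
      ladderConst_succ, mul_comm]
    simp only [Complex.ofReal_mul]

theorem innerProd_iterate_wirtingerZBar {ν : ℝ} {n : ℕ} {f g : ℂ → ℂ} (hf : f ∈ fockSpace ν n)
    (hg : g ∈ fockSpace ν 0) :
    innerProd ν (wirtingerZBar^[n] f) g = innerProd ν f ((creation ν)^[n] g) := by
  induction n generalizing f with
  | zero => rfl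
  | succ n ih =>
    rw [Function.iterate_succ_apply, ih (wirtingerZBar_mem hf), Function.iterate_succ_apply',
      innerProd_wirtingerZBar_of_mem hf (iterate_creation_mem hg n)]

theorem innerProd_iterate_iterate_wirtingerZBar {ν : ℝ} {n : ℕ} {f g : ℂ → ℂ}
    (hf : f ∈ fockSpace ν n) (hg : g ∈ fockSpace ν n) :
    innerProd ν (wirtingerZBar^[n] f) (wirtingerZBar^[n] g) =
      ladderConst ν n * innerProd ν f g := by
  rw [innerProd_iterate_wirtingerZBar hf (iterate_wirtingerZBar_mem hg),
    iterate_creation_iterate_wirtingerZBar hg, innerProd_smul_right, Complex.conj_ofReal]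

theorem innerProd_iterate_iterate_creation {ν : ℝ} {f g : ℂ → ℂ}
    (hf : f ∈ fockSpace ν 0) (hg : g ∈ fockSpace ν 0) (n : ℕ) :
    innerProd ν ((creation ν)^[n] f) ((creation ν)^[n] g) = ladderConst ν n * innerProd ν f g := by
  rw [← innerProd_iterate_wirtingerZBar (iterate_creation_mem hf n) hg,
    iterate_wirtingerZBar_iterate_creation hf, innerProd_smul_left]

/-! ### Magnetic translations -/

/-- The (unnormalised) magnetic translation `f ↦ (η ↦ e^{-ν z̄ η} f(z + η))`. -/
def magneticShift (ν : ℝ) (z : ℂ) (f : ℂ → ℂ) (η : ℂ) : ℂ :=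
  Complex.exp (-(ν * conj z * η)) * f (z + η)

theorem hasDerivAt_magneticShift_exp (ν : ℝ) (z η : ℂ) :
    HasDerivAt (fun η : ℂ => Complex.exp (-(ν * conj z * η)))
      (-(ν * conj z) * Complex.exp (-(ν * conj z * η))) η := by
  have h : HasDerivAt (fun η : ℂ => -(ν * conj z * η)) (-(ν * conj z * 1)) η :=
    ((hasDerivAt_id η).const_mul _).fun_neg
  simpa [mul_comm] using h.cexp

theorem differentiable_magneticShift_exp (ν : ℝ) (z : ℂ) :
    Differentiable ℝ (fun η : ℂ => Complex.exp (-(ν * conj z * η))) := fun η =>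
  (hasDerivAt_magneticShift_exp ν z η).differentiableAt.restrictScalars ℝ

theorem contDiff_magneticShift {ν : ℝ} {z : ℂ} {f : ℂ → ℂ} {n : WithTop ℕ∞} (hf : ContDiff ℝ n f) :
    ContDiff ℝ n (magneticShift ν z f) :=
  ((contDiff_const.mul contDiff_id).neg.cexp).mul (hf.comp (contDiff_const.add contDiff_id))

theorem wirtingerZ_comp_add_left (f : ℂ → ℂ) (z η : ℂ) :
    wirtingerZ (fun η => f (z + η)) η = wirtingerZ f (z + η) := by
  simp only [wirtingerZ, fderiv_comp_add_left]

theorem wirtingerZBar_comp_add_left (f : ℂ → ℂ) (z η : ℂ) :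
    wirtingerZBar (fun η => f (z + η)) η = wirtingerZBar f (z + η) := by
  simp only [wirtingerZBar, fderiv_comp_add_left]

theorem wirtingerZBar_magneticShift {ν : ℝ} {z : ℂ} {f : ℂ → ℂ} (hf : Differentiable ℝ f) :
    wirtingerZBar (magneticShift ν z f) = magneticShift ν z (wirtingerZBar f) := by
  ext η
  have hd : DifferentiableAt ℝ (fun η => f (z + η)) η :=
    (hf.comp (differentiable_id.const_add z)) η
  have h : magneticShift ν z f = fun η => Complex.exp (-(ν * conj z * η)) * f (z + η) := rfl
  rw [h, wirtingerZBar_mul (differentiable_magneticShift_exp ν z η) hd,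
    wirtingerZBar_of_hasDerivAt (hasDerivAt_magneticShift_exp ν z η), wirtingerZBar_comp_add_left,
    magneticShift]
  ring

theorem creation_magneticShift {ν : ℝ} {z : ℂ} {f : ℂ → ℂ} (hf : Differentiable ℝ f) :
    creation ν (magneticShift ν z f) = magneticShift ν z (creation ν f) := by
  ext η
  have hd : DifferentiableAt ℝ (fun η => f (z + η)) η :=
    (hf.comp (differentiable_id.const_add z)) η
  have h : magneticShift ν z f = fun η => Complex.exp (-(ν * conj z * η)) * f (z + η) := rfl
  rw [creation, h, wirtingerZ_mul (differentiable_magneticShift_exp ν z η) hd,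
    wirtingerZ_of_hasDerivAt (hasDerivAt_magneticShift_exp ν z η), wirtingerZ_comp_add_left,
    magneticShift, creation, map_add]
  ring

/-- The factor `e^{-ν z̄ η}` turns the translated Gaussian into a multiple of the original one. -/
theorem memLp_magneticShift {ν : ℝ} (z : ℂ) {f : ℂ → ℂ} (hf : Continuous f)
    (hf2 : MemLp f 2 (gaussMeasure ν)) : MemLp (magneticShift ν z f) 2 (gaussMeasure ν) := by
  have hc : Continuous (magneticShift ν z f) := by
    unfold magneticShift
    fun_prop
  rw [memLp_gaussMeasure_iff hf] at hf2
  rw [memLp_gaussMeasure_iff hc]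
  refine ((hf2.comp_add_left z).const_mul (Real.exp (ν * ‖z‖ ^ 2))).congr (ae_of_all _ fun η => ?_)
  simp only [magneticShift, norm_mul, Complex.norm_exp, mul_pow]
  rw [← mul_assoc, ← mul_assoc, ← Real.exp_add, ← Real.exp_nat_mul, ← Real.exp_add]
  congr 2
  have h1 : ‖z + η‖ ^ 2 = ‖z‖ ^ 2 + ‖η‖ ^ 2 + 2 * (conj z * η).re := by
    rw [← Complex.normSq_eq_norm_sq, ← Complex.normSq_eq_norm_sq, ← Complex.normSq_eq_norm_sq,
      Complex.normSq_add, ← Complex.conj_re (z * conj η)]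
    simp
  have h2 : (-(ν * conj z * η) : ℂ).re = -(ν * (conj z * η).re) := by
    rw [mul_assoc, Complex.neg_re, Complex.re_ofReal_mul]
  rw [h1, h2]
  push_cast
  ring

theorem magneticShift_mem {ν : ℝ} {n : ℕ} (z : ℂ) {f : ℂ → ℂ} (hf : f ∈ fockSpace ν n) :
    magneticShift ν z f ∈ fockSpace ν n := by
  refine mem_fockSpace_iff.2 ⟨contDiff_magneticShift hf.1,
    memLp_magneticShift z hf.1.continuous hf.2.1, ?_⟩
  rw [wirtingerZBar_magneticShift (differentiable_of_mem hf),
    creation_magneticShift ((contDiff_wirtingerZBar hf.1).differentiable one_ne_zero),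
    creation_wirtingerZBar_of_mem hf]
  ext η
  simp only [magneticShift, Pi.smul_apply, smul_eq_mul]
  ring

theorem iterate_wirtingerZBar_magneticShift {ν : ℝ} {n : ℕ} (z : ℂ) {f : ℂ → ℂ}
    (hf : f ∈ fockSpace ν n) :
    wirtingerZBar^[n] (magneticShift ν z f) = magneticShift ν z (wirtingerZBar^[n] f) := by
  induction n generalizing f with
  | zero => rfl
  | succ n ih =>
    rw [Function.iterate_succ_apply, wirtingerZBar_magneticShift (differentiable_of_mem hf),
      ih (wirtingerZBar_mem hf), Function.iterate_succ_apply]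

/-! ### Complex Hermite polynomials -/

theorem contDiff_infty_wirtingerZ {f : ℂ → ℂ} (hf : ContDiff ℝ (⊤ : ℕ∞) f) :
    ContDiff ℝ (⊤ : ℕ∞) (wirtingerZ f) := contDiff_wirtingerZ hf (by simp)

theorem contDiff_infty_wirtingerZBar {f : ℂ → ℂ} (hf : ContDiff ℝ (⊤ : ℕ∞) f) :
    ContDiff ℝ (⊤ : ℕ∞) (wirtingerZBar f) := contDiff_wirtingerZBar_of_le hf (by simp)

theorem contDiff_two_of_infty {f : ℂ → ℂ} (hf : ContDiff ℝ (⊤ : ℕ∞) f) : ContDiff ℝ 2 f :=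
  by exact_mod_cast contDiff_infty.1 hf 2

theorem differentiable_of_infty {f : ℂ → ℂ} (hf : ContDiff ℝ (⊤ : ℕ∞) f) : Differentiable ℝ f :=
  (contDiff_two_of_infty hf).differentiable two_ne_zero

theorem contDiff_infty_iterate_wirtingerZ {f : ℂ → ℂ} (hf : ContDiff ℝ (⊤ : ℕ∞) f) (n : ℕ) :
    ContDiff ℝ (⊤ : ℕ∞) (wirtingerZ^[n] f) := by
  induction n with
  | zero => exact hf
  | succ n ih => rw [Function.iterate_succ_apply']; exact contDiff_infty_wirtingerZ ih

theorem contDiff_infty_iterate_wirtingerZBar {f : ℂ → ℂ} (hf : ContDiff ℝ (⊤ : ℕ∞) f) (n : ℕ) :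
    ContDiff ℝ (⊤ : ℕ∞) (wirtingerZBar^[n] f) := by
  induction n with
  | zero => exact hf
  | succ n ih => rw [Function.iterate_succ_apply']; exact contDiff_infty_wirtingerZBar ih

theorem contDiff_infty_iterate_creation {ν : ℝ} {f : ℂ → ℂ} (hf : ContDiff ℝ (⊤ : ℕ∞) f) (n : ℕ) :
    ContDiff ℝ (⊤ : ℕ∞) ((creation ν)^[n] f) := by
  induction n with
  | zero => exact hf
  | succ n ih => rw [Function.iterate_succ_apply']; exact contDiff_creation ih (by simp)

theorem iterate_wirtinger_comm {f : ℂ → ℂ} (hf : ContDiff ℝ (⊤ : ℕ∞) f) (m n : ℕ) :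
    wirtingerZBar^[m] (wirtingerZ^[n] f) = wirtingerZ^[n] (wirtingerZBar^[m] f) := by
  have h1 : ∀ (k : ℕ) (g : ℂ → ℂ), ContDiff ℝ (⊤ : ℕ∞) g →
      wirtingerZBar (wirtingerZ^[k] g) = wirtingerZ^[k] (wirtingerZBar g) := by
    intro k g hg
    induction k generalizing g with
    | zero => rfl
    | succ k ih =>
      rw [Function.iterate_succ_apply, Function.iterate_succ_apply,
        ih _ (contDiff_infty_wirtingerZ hg),
        wirtingerZ_wirtingerZBar_comm (contDiff_two_of_infty hg)]
  induction m with
  | zero => rfl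
  | succ m ih =>
    rw [Function.iterate_succ_apply', Function.iterate_succ_apply', ih,
      h1 n _ (contDiff_infty_iterate_wirtingerZBar hf m)]

theorem conj_iterate_wirtingerZ {f : ℂ → ℂ} (hf : ContDiff ℝ (⊤ : ℕ∞) f) (n : ℕ) :
    (fun z => conj ((wirtingerZ^[n] f) z)) = wirtingerZBar^[n] (fun z => conj (f z)) := by
  induction n with
  | zero => rfl
  | succ n ih =>
    rw [Function.iterate_succ_apply', Function.iterate_succ_apply', ← ih]
    ext z
    rw [wirtingerZBar_conj (differentiable_of_infty (contDiff_infty_iterate_wirtingerZ hf n) z)]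

theorem conj_iterate_wirtingerZBar {f : ℂ → ℂ} (hf : ContDiff ℝ (⊤ : ℕ∞) f) (n : ℕ) :
    (fun z => conj ((wirtingerZBar^[n] f) z)) = wirtingerZ^[n] (fun z => conj (f z)) := by
  induction n with
  | zero => rfl
  | succ n ih =>
    rw [Function.iterate_succ_apply', Function.iterate_succ_apply', ← ih]
    ext z
    rw [wirtingerZ_conj (differentiable_of_infty (contDiff_infty_iterate_wirtingerZBar hf n) z)]

theorem hermite_eq (ν : ℝ) (m n : ℕ) (z : ℂ) : hermite ν m n z =
    (-1) ^ (m + n) * Complex.exp (ν * z * conj z) *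
      (wirtingerZBar^[m] (wirtingerZ^[n] (weight ν))) z := rfl

theorem conj_hermite (ν : ℝ) (m n : ℕ) (z : ℂ) : conj (hermite ν m n z) = hermite ν n m z := by
  have hw : ContDiff ℝ (⊤ : ℕ∞) (weight ν) := contDiff_weight ν
  have h : (fun z => conj (weight ν z)) = weight ν := funext (conj_weight ν)
  have h1 := congrFun (conj_iterate_wirtingerZBar (contDiff_infty_iterate_wirtingerZ hw n) m) z
  rw [conj_iterate_wirtingerZ hw n, h, ← iterate_wirtinger_comm hw] at h1
  rw [hermite_eq, hermite_eq, map_mul, map_mul, h1, ← Complex.exp_conj, add_comm n m]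
  simp only [map_mul, map_pow, map_neg, map_one, Complex.conj_ofReal, Complex.conj_conj]
  ring_nf

theorem iterate_wirtingerZBar_weight (ν : ℝ) (m : ℕ) :
    wirtingerZBar^[m] (weight ν) =
      fun z => weight ν z * ((-1 : ℂ) ^ m • fun z : ℂ => (ν * z) ^ m) z := by
  induction m with
  | zero => ext z; simp
  | succ m ih =>
    rw [Function.iterate_succ_apply', ih]
    ext z
    have hd : HasDerivAt ((-1 : ℂ) ^ m • fun z : ℂ => ((ν : ℂ) * z) ^ m) _ z :=
      ((((hasDerivAt_id z).const_mul (ν : ℂ)).pow m).const_smul ((-1 : ℂ) ^ m))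
    rw [wirtingerZBar_mul ((contDiff_weight ν (n := 1)).differentiable one_ne_zero z)
      (hd.differentiableAt.restrictScalars ℝ), wirtingerZBar_of_hasDerivAt hd,
      wirtingerZBar_weight]
    simp only [Pi.smul_apply, smul_eq_mul]
    ring

theorem iterate_wirtingerZ_weight_mul {ν : ℝ} {f : ℂ → ℂ} (hf : ContDiff ℝ (⊤ : ℕ∞) f) (n : ℕ) :
    wirtingerZ^[n] (fun z => weight ν z * f z) =
      (-1 : ℂ) ^ n • fun z => weight ν z * (creation ν)^[n] f z := by
  induction n with
  | zero => ext z; simp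
  | succ n ih =>
    have h1 := contDiff_infty_iterate_creation (ν := ν) hf n
    rw [Function.iterate_succ_apply', ih, wirtingerZ_smul _
      (differentiable_of_infty ((contDiff_weight ν).mul h1))]
    ext z
    rw [Pi.smul_apply, Pi.smul_apply, wirtingerZ_weight_mul (differentiable_of_infty h1 z),
      Function.iterate_succ_apply', smul_eq_mul, smul_eq_mul]
    ring

theorem memLp_pow {ν : ℝ} (hν : 0 < ν) (m : ℕ) :
    MemLp (fun z : ℂ => z ^ m) 2 (gaussMeasure ν) := by
  rw [memLp_gaussMeasure_iff (by fun_prop)]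
  refine (integrable_rpow_mul_exp_neg_mul_rpow (p := 2) (q := (2 * m : ℕ)) (b := ν) one_le_two
    (by linarith [Nat.cast_nonneg (α := ℝ) (2 * m)]) hν).congr (ae_of_all _ fun z => ?_)
  simp only [Real.rpow_natCast, Real.rpow_two, norm_pow, neg_mul]
  rw [mul_comm, ← pow_mul, mul_comm m 2]

theorem pow_mem_fockSpace {ν : ℝ} (hν : 0 < ν) (m : ℕ) :
    (fun z : ℂ => z ^ m) ∈ fockSpace ν 0 :=
  mem_fockSpace_zero (by fun_prop) (memLp_pow hν m)

theorem const_mul_pow_mem_fockSpace {ν : ℝ} (hν : 0 < ν) (m : ℕ) :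
    (fun z : ℂ => (ν * z) ^ m) ∈ fockSpace ν 0 := by
  have h := (fockSpace ν 0).smul_mem ((ν : ℂ) ^ m) (pow_mem_fockSpace hν m)
  have : (fun z : ℂ => (ν * z) ^ m) = (ν : ℂ) ^ m • fun z : ℂ => z ^ m := by
    ext z; simp [mul_pow]
  rwa [this]

/-- The Rodrigues formula in operator form: `H_{m,n} = (A⁺)^n (ν z)^m`. -/
theorem hermite_eq_iterate_creation {ν : ℝ} (hν : 0 < ν) (m n : ℕ) :
    hermite ν m n = (creation ν)^[n] fun z => (ν * z) ^ m := by
  ext z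
  have hs : ContDiff ℝ (⊤ : ℕ∞) ((-1 : ℂ) ^ m • fun z : ℂ => (ν * z) ^ m) :=
    contDiff_const.smul ((contDiff_const.mul contDiff_id).pow m)
  rw [hermite_eq, iterate_wirtinger_comm (contDiff_weight ν), iterate_wirtingerZBar_weight,
    iterate_wirtingerZ_weight_mul hs, iterate_creation_smul _ (const_mul_pow_mem_fockSpace hν m)]
  simp only [Pi.smul_apply, smul_eq_mul, weight]
  have h1 : Complex.exp (ν * z * conj z) * Complex.exp (-(ν * z * conj z)) = 1 := by
    rw [← Complex.exp_add, add_neg_cancel, Complex.exp_zero]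
  have h2 : ((-1 : ℂ) ^ (m + n)) * ((-1) ^ n * (-1) ^ m) = 1 := by
    rw [← pow_add, ← pow_add, add_comm n m, ← two_mul, pow_mul]; simp
  linear_combination ((-1 : ℂ) ^ (m + n) * ((-1) ^ n * (-1) ^ m) *
    (creation ν)^[n] (fun z => (ν * z) ^ m) z) * h1 +
    (creation ν)^[n] (fun z => (ν * z) ^ m) z * h2

theorem hermite_mem {ν : ℝ} (hν : 0 < ν) (m n : ℕ) : hermite ν m n ∈ fockSpace ν n := by
  rw [hermite_eq_iterate_creation hν]
  exact iterate_creation_mem (const_mul_pow_mem_fockSpace hν m) n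

/-! ### Taylor coefficients in the Bargmann–Fock space -/

theorem wirtingerZ_sum {ι : Type*} (s : Finset ι) {F : ι → ℂ → ℂ} {z : ℂ}
    (hF : ∀ i ∈ s, DifferentiableAt ℝ (F i) z) :
    wirtingerZ (fun w => ∑ i ∈ s, F i w) z = ∑ i ∈ s, wirtingerZ (F i) z := by
  simp only [wirtingerZ, fderiv_fun_sum hF, sum_apply, Finset.mul_sum,
    ← Finset.sum_sub_distrib]

/-- The powers of the creation operator on an entire function, expanded by the binomial theorem
(`∂/∂z` and multiplication by `ν z̄` commute). -/
theorem iterate_creation_apply {ν : ℝ} {g : ℂ → ℂ} (hg : Differentiable ℂ g) (k : ℕ) (w : ℂ) :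
    (creation ν)^[k] g w = ∑ i ∈ Finset.range (k + 1), (k.choose i : ℂ) *
      ((-1) ^ i * iteratedDeriv i g w * (ν * conj w) ^ (k - i)) := by
  induction k generalizing w with
  | zero => simp
  | succ k ih =>
    have hfun : (creation ν)^[k] g = fun w => ∑ i ∈ Finset.range (k + 1), (k.choose i : ℂ) *
      ((-1) ^ i * iteratedDeriv i g w * (ν * conj w) ^ (k - i)) := funext ih
    rw [Function.iterate_succ_apply', hfun, creation,
      Finset.sum_choose_succ_mul (fun i j => (-1) ^ i * iteratedDeriv i g w * (ν * conj w) ^ j)]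
    have hdi : ∀ i, HasDerivAt (fun w => (k.choose i : ℂ) * ((-1) ^ i * iteratedDeriv i g w))
        ((k.choose i : ℂ) * ((-1) ^ i * iteratedDeriv (i + 1) g w)) w := by
      intro i
      have h1 : Differentiable ℂ (iteratedDeriv i g) :=
        (hg.contDiff (n := (i + 1 : ℕ))).differentiable_iteratedDeriv i
          (by exact_mod_cast i.lt_succ_self)
      have h2 := (h1 w).hasDerivAt
      rw [← iteratedDeriv_succ] at h2
      exact (h2.const_mul _).const_mul _
    have hdc : ∀ j : ℕ, HasDerivAt (fun w : ℂ => ((ν : ℂ) * w) ^ j) _ w := fun j =>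
      ((hasDerivAt_id w).const_mul (ν : ℂ)).pow j
    have hcj : ∀ j : ℕ, (fun w : ℂ => ((ν : ℂ) * conj w) ^ j) =
        fun w => conj (((ν : ℂ) * w) ^ j) := by
      intro j; ext w; simp
    have hterm : ∀ j : ℕ, DifferentiableAt ℝ (fun w : ℂ => ((ν : ℂ) * conj w) ^ j) w ∧
        wirtingerZ (fun w : ℂ => ((ν : ℂ) * conj w) ^ j) w = 0 := by
      intro j
      rw [hcj]
      exact ⟨Complex.conjCLE.differentiableAt.comp w ((hdc j).differentiableAt.restrictScalars ℝ),
        wirtingerZ_conj_of_hasDerivAt (hdc j)⟩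
    have hre : ∀ i, (fun w => (k.choose i : ℂ) * ((-1) ^ i * iteratedDeriv i g w *
        (ν * conj w) ^ (k - i))) = fun w => ((k.choose i : ℂ) * ((-1) ^ i * iteratedDeriv i g w)) *
        (ν * conj w) ^ (k - i) := by
      intro i; ext w; ring
    have hd1 : ∀ i, DifferentiableAt ℝ (fun w => (k.choose i : ℂ) *
        ((-1) ^ i * iteratedDeriv i g w)) w := fun i =>
      (hdi i).differentiableAt.restrictScalars ℝ
    rw [wirtingerZ_sum _ (fun i _ => by rw [hre]; exact (hd1 i).fun_mul (hterm (k - i)).1),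
      Finset.mul_sum, ← Finset.sum_neg_distrib, add_comm]
    congr 1
    · refine Finset.sum_congr rfl fun i hi => ?_
      have : k + 1 - i = k - i + 1 := Nat.succ_sub (Nat.lt_succ_iff.1 (Finset.mem_range.1 hi))
      rw [this]
      ring
    · refine Finset.sum_congr rfl fun i hi => ?_
      rw [hre, wirtingerZ_mul (hd1 i) (hterm (k - i)).1, (hterm (k - i)).2,
        wirtingerZ_of_hasDerivAt (hdi i)]
      ring

/-- At the origin the terms carrying a power of `z̄` drop out. -/
theorem iterate_creation_apply_zero {ν : ℝ} {g : ℂ → ℂ} (hg : Differentiable ℂ g) (k : ℕ) :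
    (creation ν)^[k] g 0 = (-1) ^ k * iteratedDeriv k g 0 := by
  rw [iterate_creation_apply hg, Finset.sum_range_succ, Finset.sum_eq_zero]
  · simp
  · intro i hi
    have : k - i ≠ 0 := Nat.sub_ne_zero_of_lt (Finset.mem_range.1 hi)
    simp [this]

/-- The integrability that accompanies the change to polar coordinates. -/
theorem integrableOn_polar {F : ℂ → ℂ} (hc : Continuous F) (hF : Integrable F) :
    IntegrableOn (fun p : ℝ × ℝ => p.1 • F (Complex.polarCoord.symm p)) polarCoord.target := by
  have hcs : Continuous fun p : ℝ × ℝ => Complex.polarCoord.symm p := by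
    have : (fun p : ℝ × ℝ => Complex.polarCoord.symm p) =
      fun p => (p.1 : ℂ) * Complex.exp (p.2 * Complex.I) := funext polarCoord_symm_eq_exp
    rw [this]
    fun_prop
  refine ⟨(continuous_fst.smul (hc.comp hcs)).aestronglyMeasurable, ?_⟩
  have h := hF.2
  rw [hasFiniteIntegral_iff_enorm] at h ⊢
  rw [← Complex.lintegral_comp_polarCoord_symm] at h
  refine lt_of_le_of_lt (le_of_eq ?_) h
  refine setLIntegral_congr_fun polarCoord.open_target.measurableSet fun p hp => ?_
  have hp0 : 0 < p.1 := hp.1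
  simp only [enorm_smul, smul_eq_mul, Real.enorm_of_nonneg hp0.le]

/-- The Cauchy integral formula for derivatives on the circle of radius `r`, written with the
conjugate power. -/
theorem integral_circle_mul_conj_pow {h : ℂ → ℂ} (hh : Differentiable ℂ h) (k : ℕ) {r : ℝ}
    (hr : 0 < r) : ∫ θ in Set.Ioo (-Real.pi) Real.pi, h (r * Complex.exp (θ * Complex.I)) *
      conj (r * Complex.exp (θ * Complex.I)) ^ k =
      r ^ (2 * k) * (2 * Real.pi / k.factorial) * iteratedDeriv k h 0 := by
  have hpi : -Real.pi ≤ Real.pi := by linarith [Real.pi_pos]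
  set F : ℝ → ℂ := fun θ => h (r * Complex.exp (θ * Complex.I)) *
      conj (r * Complex.exp (θ * Complex.I)) ^ k with hF
  have hper : Function.Periodic F (2 * Real.pi) := by
    intro θ
    have : Complex.exp (((θ + 2 * Real.pi : ℝ) : ℂ) * Complex.I) =
        Complex.exp (θ * Complex.I) := by
      push_cast
      rw [add_mul, Complex.exp_add, Complex.exp_two_pi_mul_I, mul_one]
    simp only [hF, this]
  have h1 : ∫ θ in Set.Ioo (-Real.pi) Real.pi, F θ = ∫ θ in (0 : ℝ)..2 * Real.pi, F θ := by
    rw [← integral_Ioc_eq_integral_Ioo, ← intervalIntegral.integral_of_le hpi]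
    have := hper.intervalIntegral_add_eq (-Real.pi) 0
    rw [zero_add] at this
    rw [← this]
    congr 1
    ring
  have h2 := hh.differentiableOn.circleIntegral_one_div_sub_center_pow_smul (c := 0) hr k
  rw [circleIntegral] at h2
  have hr0 : (r : ℂ) ≠ 0 := by exact_mod_cast hr.ne'
  have h3 : ∀ θ : ℝ, deriv (circleMap 0 r) θ • (1 / (circleMap 0 r θ - 0) ^ (k + 1)) •
      h (circleMap 0 r θ) = (Complex.I / r ^ (2 * k)) * F θ := by
    intro θ
    have hc : conj (Complex.exp (θ * Complex.I)) = (Complex.exp (θ * Complex.I))⁻¹ := by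
      rw [← Complex.exp_conj, ← Complex.exp_neg]
      simp
    rw [deriv_circleMap, circleMap, zero_add, sub_zero]
    simp only [hF, smul_eq_mul, map_mul, Complex.conj_ofReal, hc, mul_pow, inv_pow]
    have he : Complex.exp (θ * Complex.I) ≠ 0 := Complex.exp_ne_zero _
    field_simp
    ring
  simp only [h3] at h2
  rw [intervalIntegral.integral_const_mul] at h2
  rw [h1]
  have hrk : (r : ℂ) ^ (2 * k) ≠ 0 := pow_ne_zero _ hr0
  have hI := Complex.I_ne_zero
  have hk : (k.factorial : ℂ) ≠ 0 := by exact_mod_cast k.factorial_ne_zero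
  simp only [smul_eq_mul] at h2
  field_simp at h2 ⊢
  linear_combination h2

/-- In the Bargmann–Fock space, pairing with a monomial reads off a Taylor coefficient. -/
theorem innerProd_pow {ν : ℝ} (hν : 0 < ν) {h : ℂ → ℂ} (hh : h ∈ fockSpace ν 0) (k : ℕ) :
    innerProd ν h (fun η => η ^ k) = (Real.pi / ν ^ (k + 1) : ℂ) * iteratedDeriv k h 0 := by
  have hhol := differentiable_complex_of_mem hh
  have hint := integrable_weight_mul_mul_conj hh.2.1 (memLp_pow hν k)
  have hwc := (contDiff_weight ν (n := 0)).continuous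
  have hhc := hhol.continuous
  have hcont : Continuous fun z => weight ν z * (h z * conj (z ^ k)) := by fun_prop
  have hpol := integrableOn_polar hcont hint
  rw [polarCoord_target, Measure.volume_eq_prod] at hpol
  rw [innerProd, integral_gaussMeasure, ← Complex.integral_comp_polarCoord_symm,
    polarCoord_target, Measure.volume_eq_prod, setIntegral_prod _ hpol]
  have hinner : ∀ r ∈ Set.Ioi (0 : ℝ), ∫ θ in Set.Ioo (-Real.pi) Real.pi,
      (r, θ).1 • (weight ν (Complex.polarCoord.symm (r, θ)) *
        (h (Complex.polarCoord.symm (r, θ)) * conj (Complex.polarCoord.symm (r, θ) ^ k))) =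
      ((r ^ ((2 * k + 1 : ℕ) : ℝ) * Real.exp (-ν * r ^ (2 : ℝ)) : ℝ) : ℂ) *
        ((2 * Real.pi / k.factorial) * iteratedDeriv k h 0) := by
    intro r hr
    have hw : ∀ θ : ℝ, weight ν (r * Complex.exp (θ * Complex.I)) =
        (Real.exp (-ν * r ^ (2 : ℝ)) : ℝ) := by
      intro θ
      rw [weight_eq, norm_mul, Complex.norm_exp_ofReal_mul_I, Complex.norm_real, mul_one,
        Real.norm_of_nonneg (le_of_lt hr), Real.rpow_two, neg_mul]
    simp only [polarCoord_symm_eq_exp, hw, Complex.real_smul, map_pow]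
    rw [integral_const_mul, integral_const_mul, integral_circle_mul_conj_pow hhol k hr,
      Real.rpow_natCast]
    push_cast
    ring
  rw [setIntegral_congr_fun measurableSet_Ioi hinner, integral_mul_const, integral_complex_ofReal,
    integral_rpow_mul_exp_neg_mul_rpow two_pos
      (by linarith [Nat.cast_nonneg (α := ℝ) (2 * k + 1)]) hν]
  have hq : (((2 * k + 1 : ℕ) : ℝ) + 1) / 2 = k + 1 := by push_cast; ring
  have hq' : -(((2 * k + 1 : ℕ) : ℝ) + 1) / 2 = -((k + 1 : ℕ) : ℝ) := by push_cast; ring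
  rw [hq, hq', Real.Gamma_nat_eq_factorial, Real.rpow_neg hν.le, Real.rpow_natCast]
  have hk : (k.factorial : ℂ) ≠ 0 := by exact_mod_cast k.factorial_ne_zero
  have hν0 : (ν : ℂ) ≠ 0 := by exact_mod_cast hν.ne'
  push_cast
  field_simp

/-! ### The integral transform -/

/-- Centring the integrand at `z` turns the transform into the pairing of a magnetic translate of
`ψ` with a Hermite polynomial. -/
theorem integrand_add (ν : ℝ) (n n' : ℕ) (ψ : ℂ → ℂ) (z η : ℂ) :
    integrand ν n n' ψ z (z + η) =
      weight ν η * (magneticShift ν z ψ η * conj (hermite ν n' n η)) := by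
  have h : Complex.exp (-(ν * ‖z + η‖ ^ 2) + ν * conj (z + η) * z) =
      weight ν η * Complex.exp (-(ν * conj z * η)) := by
    rw [weight, ← Complex.exp_add, ← Complex.mul_conj', map_add]
    ring_nf
  rw [integrand, h, add_sub_cancel_left, conj_hermite, magneticShift]
  ring

theorem integrable_integrand {ν : ℝ} (hν : 0 < ν) {n : ℕ} (n' : ℕ) {ψ : ℂ → ℂ}
    (hψ : ψ ∈ fockSpace ν n) (z : ℂ) : Integrable (integrand ν n n' ψ z) := by
  have h := integrable_weight_mul_mul_conj (magneticShift_mem z hψ).2.1 (hermite_mem hν n' n).2.1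
  have h2 := h.comp_add_left (-z)
  refine h2.congr (ae_of_all _ fun ξ => ?_)
  simp only [← integrand_add, add_neg_cancel_left]

theorem integral_integrand (ν : ℝ) (n n' : ℕ) (ψ : ℂ → ℂ) (z : ℂ) :
    ∫ ξ, integrand ν n n' ψ z ξ = innerProd ν (magneticShift ν z ψ) (hermite ν n' n) := by
  rw [← integral_add_left_eq_self _ z, innerProd, integral_gaussMeasure]
  simp only [integrand_add]

theorem iterate_creation_magneticShift {ν : ℝ} {g : ℂ → ℂ} (hg : g ∈ fockSpace ν 0) (z : ℂ)
    (k : ℕ) : (creation ν)^[k] (magneticShift ν z g) = magneticShift ν z ((creation ν)^[k] g) := by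
  induction k with
  | zero => rfl
  | succ k ih =>
    rw [Function.iterate_succ_apply', ih,
      creation_magneticShift (differentiable_of_mem (iterate_creation_mem hg k)),
      Function.iterate_succ_apply']

/-- On `ψ ∈ 𝓕_n` the transform is a multiple of `(A⁺)^{n'} (∂/∂z̄)^n`. -/
theorem transform_eq {ν : ℝ} (hν : 0 < ν) {n : ℕ} (n' : ℕ) {ψ : ℂ → ℂ} (hψ : ψ ∈ fockSpace ν n) :
    transform ν n n' ψ = (((Real.sqrt (ladderConst ν n * ladderConst ν n'))⁻¹ : ℝ) : ℂ) •
      (creation ν)^[n'] (wirtingerZBar^[n] ψ) := by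
  ext z
  have hg := iterate_wirtingerZBar_mem hψ
  have hm := magneticShift_mem z hg
  have hpow : (fun z : ℂ => (ν * z) ^ n') = (ν : ℂ) ^ n' • fun z : ℂ => z ^ n' := by
    ext z; simp [mul_pow]
  -- The value at `z` is the value at `0` after the magnetic translation, which commutes with `A⁺`.
  have hval : (creation ν)^[n'] (wirtingerZBar^[n] ψ) z =
      (-1) ^ n' * iteratedDeriv n' (magneticShift ν z (wirtingerZBar^[n] ψ)) 0 := by
    rw [← iterate_creation_apply_zero (ν := ν) (differentiable_complex_of_mem hm),
      iterate_creation_magneticShift hg]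
    simp [magneticShift]
  have hI : ∫ ξ, integrand ν n n' ψ z ξ =
      (Real.pi / ν : ℂ) * iteratedDeriv n' (magneticShift ν z (wirtingerZBar^[n] ψ)) 0 := by
    rw [integral_integrand, hermite_eq_iterate_creation hν,
      ← innerProd_iterate_wirtingerZBar (magneticShift_mem z hψ)
        (const_mul_pow_mem_fockSpace hν n'),
      iterate_wirtingerZBar_magneticShift z hψ, hpow, innerProd_smul_right,
      innerProd_pow hν hm]
    have hν0 : (ν : ℂ) ≠ 0 := by exact_mod_cast hν.ne'
    simp only [map_pow, Complex.conj_ofReal]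
    field_simp
    ring
  have hs : (n.factorial : ℝ) * n'.factorial * ν ^ (n + n') =
      ladderConst ν n * ladderConst ν n' := by
    simp only [ladderConst, pow_add]
    ring
  rw [transform, hI, hs, Pi.smul_apply, smul_eq_mul, hval]
  have hν0 : (ν : ℂ) ≠ 0 := by exact_mod_cast hν.ne'
  have hpi : (Real.pi : ℂ) ≠ 0 := by exact_mod_cast Real.pi_ne_zero
  push_cast
  field_simp

theorem ladderConst_pos {ν : ℝ} (hν : 0 < ν) (n : ℕ) : 0 < ladderConst ν n := by
  unfold ladderConst
  positivity

theorem transform_mem {ν : ℝ} (hν : 0 < ν) {n : ℕ} (n' : ℕ) {ψ : ℂ → ℂ} (hψ : ψ ∈ fockSpace ν n) :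
    transform ν n n' ψ ∈ fockSpace ν n' := by
  rw [transform_eq hν n' hψ]
  exact (fockSpace ν n').smul_mem _ (iterate_creation_mem (iterate_wirtingerZBar_mem hψ) n')

theorem transform_add {ν : ℝ} (hν : 0 < ν) {n : ℕ} (n' : ℕ) {φ ψ : ℂ → ℂ} (hφ : φ ∈ fockSpace ν n)
    (hψ : ψ ∈ fockSpace ν n) :
    transform ν n n' (φ + ψ) = transform ν n n' φ + transform ν n n' ψ := by
  ext z
  have h : integrand ν n n' (φ + ψ) z =
      fun ξ => integrand ν n n' φ z ξ + integrand ν n n' ψ z ξ := by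
    ext ξ
    simp only [integrand, Pi.add_apply, mul_add]
  rw [transform, h, integral_add (integrable_integrand hν n' hφ z)
    (integrable_integrand hν n' hψ z),
    mul_add]
  rfl

theorem transform_smul (ν : ℝ) (n n' : ℕ) (c : ℂ) (ψ : ℂ → ℂ) :
    transform ν n n' (c • ψ) = c • transform ν n n' ψ := by
  ext z
  have h : integrand ν n n' (c • ψ) z = fun ξ => c * integrand ν n n' ψ z ξ := by
    ext ξ
    simp only [integrand, Pi.smul_apply, smul_eq_mul]
    ring
  rw [transform, h, integral_const_mul, Pi.smul_apply, smul_eq_mul, transform]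
  ring

theorem inv_sqrt_mul_inv_sqrt_mul {a : ℝ} (ha : 0 < a) :
    (Real.sqrt a)⁻¹ * ((Real.sqrt a)⁻¹ * a) = 1 := by
  rw [← mul_assoc, ← mul_inv, Real.mul_self_sqrt ha.le, inv_mul_cancel₀ ha.ne']

/-- Since `(∂/∂z̄)^n (A⁺)^n` is the scalar `n! ν^n` on the lowest space, and likewise for
`(A⁺)^n (∂/∂z̄)^n` on the level `n`, the transforms are inverse to each other. -/
theorem transform_transform {ν : ℝ} (hν : 0 < ν) {n : ℕ} (n' : ℕ) {ψ : ℂ → ℂ}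
    (hψ : ψ ∈ fockSpace ν n) : transform ν n' n (transform ν n n' ψ) = ψ := by
  have hg := iterate_wirtingerZBar_mem hψ
  have h1 := iterate_creation_mem hg n'
  have hpos := mul_pos (ladderConst_pos hν n) (ladderConst_pos hν n')
  rw [transform_eq hν n' hψ, transform_smul, transform_eq hν n h1,
    iterate_wirtingerZBar_iterate_creation hg, iterate_creation_smul _ hg,
    iterate_creation_iterate_wirtingerZBar hψ, smul_smul, smul_smul, smul_smul,
    mul_comm (ladderConst ν n') (ladderConst ν n)]
  have h := inv_sqrt_mul_inv_sqrt_mul hpos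
  convert one_smul ℂ ψ using 2
  rw [← Complex.ofReal_one, ← h]
  push_cast
  ring

theorem innerProd_transform {ν : ℝ} (hν : 0 < ν) {n : ℕ} (n' : ℕ) {φ ψ : ℂ → ℂ}
    (hφ : φ ∈ fockSpace ν n) (hψ : ψ ∈ fockSpace ν n) :
    innerProd ν (transform ν n n' φ) (transform ν n n' ψ) = innerProd ν φ ψ := by
  have hpos := mul_pos (ladderConst_pos hν n) (ladderConst_pos hν n')
  rw [transform_eq hν n' hφ, transform_eq hν n' hψ, innerProd_smul_left, innerProd_smul_right,
    innerProd_iterate_iterate_creation (iterate_wirtingerZBar_mem hφ)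
      (iterate_wirtingerZBar_mem hψ),
    innerProd_iterate_iterate_wirtingerZBar hφ hψ, Complex.conj_ofReal]
  have h : ((_ : ℝ) : ℂ) = _ := congrArg Complex.ofReal (inv_sqrt_mul_inv_sqrt_mul hpos)
  push_cast at h ⊢
  linear_combination (innerProd ν φ ψ) * h

theorem transform_hermite {ν : ℝ} (hν : 0 < ν) (m n n' : ℕ) : transform ν n n' (hermite ν m n) =
    (Real.sqrt (ladderConst ν n / ladderConst ν n') : ℂ) • hermite ν m n' := by
  have hp := const_mul_pow_mem_fockSpace hν m
  have ha := ladderConst_pos hν n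
  have hb := ladderConst_pos hν n'
  rw [transform_eq hν n' (hermite_mem hν m n), hermite_eq_iterate_creation hν,
    hermite_eq_iterate_creation hν, iterate_wirtingerZBar_iterate_creation hp,
    iterate_creation_smul _ hp, smul_smul, ← Complex.ofReal_mul]
  have : (Real.sqrt (ladderConst ν n * ladderConst ν n'))⁻¹ * ladderConst ν n =
      Real.sqrt (ladderConst ν n / ladderConst ν n') := by
    rw [eq_comm, Real.sqrt_eq_iff_mul_self_eq_of_pos (by positivity), mul_mul_mul_comm, ← mul_inv,
      Real.mul_self_sqrt (by positivity)]
    field_simp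
  rw [this]

/-- The transform as a linear equivalence between generalized Bargmann–Fock spaces. -/
def transformEquiv {ν : ℝ} (hν : 0 < ν) (n n' : ℕ) : fockSpace ν n ≃ₗ[ℂ] fockSpace ν n' where
  toFun ψ := ⟨transform ν n n' ψ, transform_mem hν n' ψ.2⟩
  map_add' φ ψ := Subtype.ext (transform_add hν n' φ.2 ψ.2)
  map_smul' c ψ := Subtype.ext (transform_smul ν n n' c ψ)
  invFun φ := ⟨transform ν n' n φ, transform_mem hν n φ.2⟩
  left_inv ψ := Subtype.ext (transform_transform hν n' ψ.2)
  right_inv φ := Subtype.ext (transform_transform hν n φ.2)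

end BargmannFock
end

theorem mainTheorem2 (ν : ℝ) (hν : 0 < ν) (n n' : ℕ) :
    (∀ ψ ∈ BargmannFock.fockSpace ν n, ∀ z : ℂ,
      Integrable (BargmannFock.integrand ν n n' ψ z)) ∧
    (∃ U : BargmannFock.fockSpace ν n ≃ₗ[ℂ] BargmannFock.fockSpace ν n',
      (∀ ψ, (U ψ : ℂ → ℂ) = BargmannFock.transform ν n n' ψ) ∧
      (∀ φ, (U.symm φ : ℂ → ℂ) = BargmannFock.transform ν n' n φ) ∧
      (∀ φ ψ, BargmannFock.innerProd ν (U φ) (U ψ) = BargmannFock.innerProd ν φ ψ)) ∧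
    (∀ m : ℕ, BargmannFock.hermite ν m n ∈ BargmannFock.fockSpace ν n ∧
      ∀ z : ℂ, BargmannFock.transform ν n n' (BargmannFock.hermite ν m n) z =
        (Real.sqrt (n.factorial * ν ^ n / (n'.factorial * ν ^ n')) : ℂ) *
          BargmannFock.hermite ν m n' z) := by
  refine ⟨fun ψ hψ z => BargmannFock.integrable_integrand hν n' hψ z,
    ⟨BargmannFock.transformEquiv hν n n', fun _ => rfl, fun _ => rfl,
      fun φ ψ => BargmannFock.innerProd_transform hν n' φ.2 ψ.2⟩,
    fun m => ⟨BargmannFock.hermite_mem hν m n, fun z => ?_⟩⟩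
  rw [BargmannFock.transform_hermite hν]
  rfl
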